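/- Fix integers $1\le r\le K$ and $T\ge 1$ and a real $\gamma>2$. **Random graph.** Let $d_1,\dots,d_n$ be i.i.d. with density $(\gamma-1)x^{-\gamma}$ on $[1,\infty)$ (so that $\mathbb E[d_1]=\frac{\gamma-1}{\gamma-2}$) and put $\rho=1/\sum_{k=1}^n d_k$. Given $d_1,\dots,d_n$, every unordered pair $\{i,j\}$ of vertices in $[n]$ ($i=j$ allowed) is, independently of the others, an edge of the undirected graph $\mathcal G$ with probability $\min(1,\rho\, d_id_j)$. This is the power law model $\mathrm{PL}(n,\gamma,\rho)$. **Allocations.** An allocation $A\in\mathcal A_n(r)$ consists of sets $\mathcal M_1,\dots,\mathcal M_K\subseteq[n]$ covering $[n]$ with $\sum_k|\mathcal M_k|=rn$, and a partition $[n]=\mathcal R_1\sqcup\dots\sqcup\mathcal R_K$, such that the sizes $|\mathcal M_k|$ differ from each other by at most $1$ and so do the sizes $|\mathcal R_k|$ (hence $|\mathcal M_k|=rn/K$ and $|\mathcal R_k|=n/K$ if $K\mid n$). **Loads.** For a graph $G$ and an allocation $A$, there is a $T$-bit intermediate value $v_{i,j}$ for every ordered pair $(i,j)$ with $\{i,j\}$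 an edge of $G$. Machine $k$ knows the $v_{i,j}$ with $j\in\mathcal M_k$ and needs the $v_{i,j}$ with $i\in\mathcal R_k$, $j\notin\mathcal M_k$. In a feasible shuffling scheme each machine $k$ multicasts $c_k$ bits, a function of the values it knows, such that for all possible values $(v_{i,j})$ every machine recovers the values it needs from the values it knows and the messages of the other machines; the load of the scheme is $\frac{1}{n^2T}\sum_k c_k$. Let $L_A(r,G)$ be the minimum load of a feasible scheme, let $L^{\mathrm{UC}}_A(r,G)=\frac1{n^2}\sum_k\#\{(i,j): \{i,j\}\in G,\ i\in\mathcal R_k,\ j\notin\mathcal M_k\}$ be the load of uncoded shuffling (every needed value is sent on its own), and let $$L^*(r)=\inf_{A\in\mathcal A_n(r)}\mathbb E_{\mathcal G}\big[L_A(r,\mathcal G)\big].$$ **Theorem.** $$\limsup_{n\to\infty}\frac{n\,L^*(r)}{\left(\frac{\gamma-1}{\gamma-2}\right)}\ \le\ \frac1r\Big(1-\frac rK\Big),$$ whereas for every sequence of allocations $A_n\in\mathcal A_n(r)$ the average uncoded load satisfies $$\lim_{n\to\infty} n\,\mathbb E_{\mathcal G}\big[L^{\mathrm{UC}}_{A_n}(r,\mathcal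 G)\big]=\Big(1-\frac rK\Big)\frac{\gamma-1}{\gamma-2}.$$ -/

import Mathlib

open MeasureTheory ProbabilityTheory Filter Topology
open scoped ENNReal

namespace CodedGraph

/-! ### Random graphs -/

/-- Undirected graphs on the vertex set `Fin n`, with self-loops allowed: a graph records for each
unordered pair `s(i, j)` (with `i = j` allowed) whether it is an edge. -/
abbrev LoopGraph (n : ℕ) : Type := Sym2 (Fin n) → Bool

/-- `j` is a neighbour of `i` in `G`. -/
def LoopGraph.Adj {n : ℕ} (G : LoopGraph n) (i j : Fin n) : Prop := G s(i, j) = true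

/-- The law of the expected degree sequence: `d_1, …, d_n` are independent, each with the power law
density `(γ - 1) x ^ (-γ)` on `[1, ∞)`. -/
noncomputable def degreeLaw (n : ℕ) (γ : ℝ) : Measure (Fin n → ℝ) :=
  Measure.pi fun _ => paretoMeasure 1 (γ - 1)

/-- The normalizing factor `ρ = 1 / (d_1 + ⋯ + d_n)`. -/
noncomputable def rho {n : ℕ} (d : Fin n → ℝ) : ℝ := (∑ k, d k)⁻¹

/-- The product `d_i d_j` as a function of the unordered pair `s(i, j)`. -/
def degreeProd {n : ℕ} (d : Fin n → ℝ) : Sym2 (Fin n) → ℝ :=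
  Sym2.lift ⟨fun i j => d i * d j, fun i j => mul_comm (d i) (d j)⟩

/-- The probability of the edge `s(i, j)` given the expected degrees: `ρ d_i d_j`, capped at `1`
(for positive degrees, `min 1 (ρ d_i d_j)`). -/
noncomputable def edgeProb {n : ℕ} (d : Fin n → ℝ) (e : Sym2 (Fin n)) : unitInterval :=
  Set.projIcc 0 1 zero_le_one (rho d * degreeProd d e)

/-- The law of the graph given the expected degrees: every edge `e` is present with probability
`edgeProb d e`, independently of all other edges. -/
noncomputable def edgeLaw {n : ℕ} (d : Fin n → ℝ) : Measure (LoopGraph n) :=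
  Measure.pi fun e => bernoulliMeasure true false (edgeProb d e)

/-- The law of the power law random graph on `n` vertices: first draw the expected degrees, then the
edges. -/
noncomputable def powerLawGraph (n : ℕ) (γ : ℝ) : Measure (LoopGraph n) :=
  (degreeLaw n γ).bind edgeLaw

instance {n : ℕ} (d : Fin n → ℝ) : IsProbabilityMeasure (edgeLaw d) := by
  unfold edgeLaw; infer_instance

lemma measurable_edgeProb {n : ℕ} (e : Sym2 (Fin n)) :
    Measurable fun d : Fin n → ℝ => edgeProb d e := by
  have h : Measurable fun d : Fin n → ℝ => rho d * degreeProd d e := by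
    refine Measurable.mul ?_ ?_
    · unfold rho; fun_prop
    · induction e with
      | h i j => simp only [degreeProd, Sym2.lift_mk]; fun_prop
  exact continuous_projIcc.measurable.comp h

/-- The conditional law of the graph depends measurably on the degrees, so that `powerLawGraph` is
a genuine mixture. -/
lemma measurable_edgeLaw {n : ℕ} :
    Measurable (edgeLaw : (Fin n → ℝ) → Measure (LoopGraph n)) := by
  classical
  refine Measure.measurable_of_measurable_coe _ fun s _ => ?_
  have hs : ∀ d : Fin n → ℝ, edgeLaw d s
      = ∑ G ∈ s.toFinset, ∏ e, bernoulliMeasure true false (edgeProb d e) {G e} := by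
    intro d
    rw [← Set.coe_toFinset s, ← sum_measure_singleton]
    simp [edgeLaw]
  simp_rw [hs]
  refine Finset.measurable_sum _ fun G _ => Finset.measurable_prod _ fun e _ => ?_
  have h := measurable_edgeProb e
  cases hG : G e
  · simp only [bernoulliMeasure_apply _ (measurableSet_singleton _)]
    simp only [Set.mem_singleton_iff, Bool.true_eq_false, if_true, if_false]
    exact ((unitInterval.continuous_symm.measurable.comp h).subtype_val.subtype_mk).coe_nnreal_ennreal
  · simp only [bernoulliMeasure_apply _ (measurableSet_singleton _)]
    simp only [Set.mem_singleton_iff, Bool.false_eq_true, if_true, if_false]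
    exact (h.subtype_val.subtype_mk).coe_nnreal_ennreal

lemma isProbabilityMeasure_powerLawGraph (n : ℕ) {γ : ℝ} (hγ : 1 < γ) :
    IsProbabilityMeasure (powerLawGraph n γ) := by
  have := isProbabilityMeasure_paretoMeasure one_pos (sub_pos.2 hγ)
  refine ⟨?_⟩
  rw [powerLawGraph, Measure.bind_apply MeasurableSet.univ measurable_edgeLaw.aemeasurable]
  simp [degreeLaw]

/-! ### Distributed computation -/

/-- A subgraph and computation allocation of `n` vertices to `K` machines with computation load `r`.
Machine `k` Maps the vertices in `map k` and Reduces the vertices in `reduce k`. Every vertex is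
Mapped by some machine, the computation load `∑ k, |map k| / n` is `r`, every vertex is Reduced by
exactly one machine, and the machines share both tasks equally: the sizes differ by at most one, so
that `|map k| = r n / K` and `|reduce k| = n / K` whenever `K` divides `n`. -/
structure Allocation (n K r : ℕ) where
  map : Fin K → Finset (Fin n)
  reduce : Fin K → Finset (Fin n)
  map_cover : ∀ i, ∃ k, i ∈ map k
  map_load : ∑ k, (map k).card = r * n
  map_equal : ∀ k l, (map k).card ≤ (map l).card + 1
  reduce_partition : ∀ i, ∃! k, i ∈ reduce k
  reduce_equal : ∀ k l, (reduce k).card ≤ (reduce l).card + 1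

variable {n K r : ℕ}

/-- The ordered pairs `(i, j)` for which there is an intermediate value `v_{i,j}`, which is computed
by Mapping `j` and is needed for Reducing `i`. -/
def ValueIdx (G : LoopGraph n) : Set (Fin n × Fin n) := {p | G.Adj p.1 p.2}

/-- The indices of the intermediate values that machine `k` computes locally in the Map phase. -/
def LocalIdx (G : LoopGraph n) (A : Allocation n K r) (k : Fin K) : Set (Fin n × Fin n) :=
  {p | p ∈ ValueIdx G ∧ p.2 ∈ A.map k}

/-- The indices of the intermediate values that machine `k` has to recover in the Shuffle phase. -/
def NeededIdx (G : LoopGraph n) (A : Allocation n K r) (k : Fin K) : Set (Fin n × Fin n) :=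
  {p | p ∈ ValueIdx G ∧ p.1 ∈ A.reduce k ∧ p.2 ∉ A.map k}

/-- Binary words of length `T`. -/
abbrev Word (T : ℕ) : Type := Fin T → Bool

/-- A feasible Shuffling coding scheme for intermediate values of `T` bits, given the graph `G` and
the allocation `A`. Machine `k` multicasts a message of `len k` bits, computed from its local
intermediate values; from these and the messages of the other machines, every machine recovers all
the intermediate values it needs, whatever the intermediate values are. -/
structure ShuffleScheme (G : LoopGraph n) (A : Allocation n K r) (T : ℕ) where
  len : Fin K → ℕ
  encode : ∀ k, (LocalIdx G A k → Word T) → Word (len k)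
  decode : ∀ k, (LocalIdx G A k → Word T) → (∀ l, l ≠ k → Word (len l)) →
    NeededIdx G A k → Word T
  correct : ∀ (v : ValueIdx G → Word T) (k : Fin K),
    decode k (fun p => v ⟨p.1, p.2.1⟩) (fun l _ => encode l fun p => v ⟨p.1, p.2.1⟩)
      = fun p => v ⟨p.1, p.2.1⟩

/-- The normalized communication load of `b` bits: `b / (n² T)`. -/
noncomputable def normalizedLoad (n T b : ℕ) : ℝ≥0∞ := (b : ℝ≥0∞) / ((n : ℝ≥0∞) ^ 2 * T)

/-- `L_A(r, G)`: the minimum normalized communication load over all feasible Shuffling schemes. -/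
noncomputable def minLoad (T : ℕ) (A : Allocation n K r) (G : LoopGraph n) : ℝ≥0∞ :=
  ⨅ S : ShuffleScheme G A T, normalizedLoad n T (∑ k, S.len k)

/-- The normalized communication load of uncoded Shuffling, in which every needed intermediate value
is sent on its own. -/
noncomputable def uncodedLoad (T : ℕ) (A : Allocation n K r) (G : LoopGraph n) : ℝ≥0∞ :=
  normalizedLoad n T (∑ k, (NeededIdx G A k).ncard * T)

/-- `L*(r)`: the minimum, over all allocations with computation load `r`, of the average of
`L_A(r, G)` when the graph `G` has law `μ`. -/
noncomputable def minAverageLoad (K r T : ℕ) (μ : Measure (LoopGraph n)) : ℝ≥0∞ :=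
  ⨅ A : Allocation n K r, ∫⁻ G, minLoad T A G ∂μ

end CodedGraph

/-! Write m = (γ - 1)/(γ - 2) for the mean of the degree law, finite because γ > 2.

Coded bound. Every r-set of machines Maps a batch of about n / C(K,r) vertices
(`exists_batched_allocation`). For a set S of r + 1 machines and k in S, the values that k needs
from the batch of S \ {k} are known to all other members of S. Their bits are spread over these r
members as senders; each sender broadcasts XORs containing at most one bit per receiver, and a
receiver knows every summand but its own (`exists_coded_shuffleScheme`). A transmitted bit can thus
serve r machines at once. About n m / (K C(K,r)) edges belong to each pair (k, S), so n times the
load is asymptotically at most (r+1)/r · C(K,r+1) m / (K C(K,r)) = (m/r)(1 - r/K).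

The cost of S is governed by the largest edge count over k in S, so means alone do not suffice: the
expected positive part of the excess of each count over its target must be o(n)
(`eventually_lintegral_card_edgesBetween_sub_le`). Given the degrees this is a variance bound. For
the degrees themselves the second moment is infinite when γ ≤ 3, so a law of large numbers in L¹ is
used (`eventually_integral_abs_sum_sub_le`).

Uncoded limit. In any allocation the pairs (Reduced by k, not Mapped by k) number n²(1 - r/K) +
O(n). The excess bound gives the upper estimate. The lower one comes from an edge probability of at
least (m - o(1))/n for distinct vertices (`eventually_le_lintegral_edge`), loops being negligible.
-/

namespace CodedGraph

/-! ### Shuffling schemes -/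

section Schemes

variable {n K r T : ℕ}

/-- Encoders determine a feasible scheme as soon as they only depend on local values and the local
values together with the received messages determine the needed values. -/
theorem exists_shuffleScheme {G : LoopGraph n} {A : Allocation n K r} {M : Fin K → Type}
    [∀ k, Fintype (M k)] (enc : ∀ k, (Fin n × Fin n → Word T) → M k → Bool)
    (hloc : ∀ k v v', (∀ p ∈ LocalIdx G A k, v p = v' p) → enc k v = enc k v')
    (hdec : ∀ k v v', (∀ p ∈ LocalIdx G A k, v p = v' p) → (∀ l, l ≠ k → enc l v = enc l v') →
      ∀ p ∈ NeededIdx G A k, v p = v' p) :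
    ∃ S : ShuffleScheme G A T, ∀ k, S.len k = Fintype.card (M k) := by
  classical
  -- Encoders act on assignments to all pairs; missing values are filled in with `false`, which is
  -- harmless because `hloc` makes encoders blind to non-local values.
  let tot : (ValueIdx G → Word T) → Fin n × Fin n → Word T := fun v p =>
    if h : p ∈ ValueIdx G then v ⟨p, h⟩ else fun _ => false
  let ext : ∀ k, (LocalIdx G A k → Word T) → Fin n × Fin n → Word T := fun k u p =>
    if h : p ∈ LocalIdx G A k then u ⟨p, h⟩ else fun _ => false
  let msg : ∀ k, (LocalIdx G A k → Word T) → Word (Fintype.card (M k)) := fun k u =>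
    enc k (ext k u) ∘ (Fintype.equivFin (M k)).symm
  have htot : ∀ (v : ValueIdx G → Word T) p (h : p ∈ ValueIdx G), tot v p = v ⟨p, h⟩ :=
    fun v p h => dif_pos h
  have hmsg : ∀ k (v : ValueIdx G → Word T),
      enc k (ext k fun p => v ⟨p.1, p.2.1⟩) = enc k (tot v) := by
    intro k v
    refine hloc k _ _ fun p hp => ?_
    rw [htot v p hp.1]
    exact dif_pos hp
  refine ⟨{ len := fun k => Fintype.card (M k)
            encode := msg
            -- The decoder picks any assignment consistent with what it sees; `hdec` forces it to
            -- agree with the true one on the needed values.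
            decode := fun k u w p =>
              if h : ∃ v : ValueIdx G → Word T, (fun p : LocalIdx G A k => v ⟨p.1, p.2.1⟩) = u ∧
                (fun (l : Fin K) (_ : l ≠ k) => msg l fun p => v ⟨p.1, p.2.1⟩) = w
              then h.choose ⟨p.1, p.2.1⟩ else fun _ => false
            correct := ?_ }, fun k => rfl⟩
  intro v k
  have hex : ∃ v' : ValueIdx G → Word T,
      (fun p : LocalIdx G A k => v' ⟨p.1, p.2.1⟩) = (fun p => v ⟨p.1, p.2.1⟩) ∧
      (fun (l : Fin K) (_ : l ≠ k) => msg l fun p => v' ⟨p.1, p.2.1⟩)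
        = (fun l _ => msg l fun p => v ⟨p.1, p.2.1⟩) := ⟨v, rfl, rfl⟩
  funext p
  rw [dif_pos hex]
  obtain ⟨h1, h2⟩ := hex.choose_spec
  have key := hdec k (tot hex.choose) (tot v) ?_ ?_ p.1 p.2
  · rwa [htot _ _ p.2.1, htot _ _ p.2.1] at key
  · intro q hq
    rw [htot _ _ hq.1, htot _ _ hq.1]
    exact congrFun h1 ⟨q, hq⟩
  · intro l hl
    have h3 := congrFun (congrFun h2 l) hl
    rw [← hmsg, ← hmsg]
    funext x
    have h4 := congrFun h3 (Fintype.equivFin (M l) x)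
    simpa [msg] using h4

lemma exists_injOn_mapsTo {α β : Type*} [Nonempty β] {s : Finset α} {t : Finset β}
    (h : s.card ≤ t.card) : ∃ f : α → β, Set.InjOn f s ∧ Set.MapsTo f s t := by
  classical
  have : Fintype.card s ≤ Fintype.card t := by simpa using h
  obtain ⟨e⟩ := Function.Embedding.nonempty_of_card_le this
  refine ⟨fun a => if ha : a ∈ s then e ⟨a, ha⟩ else Classical.arbitrary β, ?_, ?_⟩
  · intro a ha b hb hab
    have ha' : a ∈ s := ha
    have hb' : b ∈ s := hb
    simp only [ha', hb', dif_pos] at hab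
    have := e.injective (Subtype.ext hab)
    simpa using this
  · intro a ha
    have ha' : a ∈ s := ha
    simp only [ha', dif_pos]
    exact (e ⟨a, ha'⟩).2

/-- The directed edges from a vertex of `R` to a vertex of `B`. -/
def edgesBetween (G : LoopGraph n) (R B : Finset (Fin n)) : Finset (Fin n × Fin n) :=
  (R ×ˢ B).filter fun p => G s(p.1, p.2) = true

/-- The vertices whose batch is `S`. -/
def batch (f : Fin n → Finset (Fin K)) (S : Finset (Fin K)) : Finset (Fin n) :=
  Finset.univ.filter fun j => f j = S

/-- The coded Shuffling scheme: for every set `S` of `r + 1` machines, every machine of `S` sends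
`ℓ S` sums of bits, each of which is needed by one machine of `S` and known to all the others. -/
theorem exists_coded_shuffleScheme {G : LoopGraph n} {A : Allocation n K r}
    (f : Fin n → Finset (Fin K)) (hf : ∀ j k, k ∈ f j ↔ j ∈ A.map k) (hcard : ∀ j, (f j).card = r)
    (ℓ : Finset (Fin K) → ℕ)
    (hℓ : ∀ S : Finset (Fin K), S.card = r + 1 → ∀ k ∈ S,
      (edgesBetween G (A.reduce k) (batch f (S.erase k))).card * T ≤ r * ℓ S) :
    ∃ S : ShuffleScheme G A T,
      ∑ k, S.len k = ∑ S ∈ Finset.univ.powersetCard (r + 1), (r + 1) * ℓ S := by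
  classical
  choose own hown huniq using A.reduce_partition
  let bits : Fin K → Finset (Fin K) → Finset ((Fin n × Fin n) × Fin T) := fun k S =>
    edgesBetween G (A.reduce k) (batch f (S.erase k)) ×ˢ Finset.univ
  -- `ψ` gives each bit needed by `k` a sender in `S \ {k}` and a slot below `ℓ S`; the capacity `r
  -- * ℓ S` suffices by `hℓ`.
  have hψ : ∀ (k : Fin K) (S : Finset (Fin K)), ∃ ψ : (Fin n × Fin n) × Fin T → Fin K × ℕ,
      S.card = r + 1 → k ∈ S →
      Set.InjOn ψ (bits k S) ∧
      Set.MapsTo ψ (bits k S) (S.erase k ×ˢ Finset.range (ℓ S) : Finset (Fin K × ℕ)) := by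
    intro k S
    by_cases hS : S.card = r + 1 ∧ k ∈ S
    · have : Nonempty (Fin K × ℕ) := ⟨(k, 0)⟩
      obtain ⟨ψ, h1, h2⟩ := exists_injOn_mapsTo
        (s := bits k S) (t := S.erase k ×ˢ Finset.range (ℓ S)) (by
          rw [Finset.card_product, Finset.card_product, Finset.card_erase_of_mem hS.2, hS.1]
          simpa using hℓ S hS.1 k hS.2)
      exact ⟨ψ, fun _ _ => ⟨h1, h2⟩⟩
    · exact ⟨fun _ => (k, 0), fun h1 h2 => absurd ⟨h1, h2⟩ hS⟩
  choose ψ hψ using hψ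
  -- A needed pair determines its group S: its Reducer together with the r machines that Map its
  -- second vertex.
  let cls : Fin n × Fin n → Finset (Fin K) := fun p => insert (own p.1) (f p.2)
  let needed : Fin n × Fin n → Prop := fun p => G s(p.1, p.2) = true ∧ own p.1 ∉ f p.2
  let φ : (Fin n × Fin n) × Fin T → Fin K × ℕ := fun q => ψ (own q.1.1) (cls q.1) q
  have hcls : ∀ p, needed p → (cls p).card = r + 1 := fun p hp => by
    rw [Finset.card_insert_of_notMem hp.2, hcard]
  have hmem : ∀ q : (Fin n × Fin n) × Fin T, needed q.1 → q ∈
      bits (own q.1.1) (cls q.1) := by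
    intro q hq
    simp [bits, edgesBetween, batch, hq.1, hown, cls, Finset.erase_insert hq.2]
  have hφ : ∀ q, needed q.1 → (φ q).1 ∈ f q.1.2 ∧ (φ q).2 < ℓ (cls q.1) := by
    intro q hq
    have := (hψ (own q.1.1) (cls q.1) (hcls _ hq) (Finset.mem_insert_self _ _)).2 (hmem q hq)
    rw [Finset.coe_product] at this
    obtain ⟨h1, h2⟩ := this
    refine ⟨?_, by simpa using h2⟩
    rwa [Finset.erase_insert hq.2] at h1
  have hinj : ∀ q q', needed q.1 → needed q'.1 → own q.1.1 = own q'.1.1 → cls q.1 = cls q'.1 →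
      φ q = φ q' → q = q' := by
    intro q q' hq hq' ho hc he
    refine (hψ (own q.1.1) (cls q.1) (hcls _ hq) (Finset.mem_insert_self _ _)).1 (hmem q hq) ?_ ?_
    · rw [ho, hc]; exact hmem q' hq'
    · simp only [φ] at he
      rw [he, ho, hc]
  let M : Fin K → Type := fun s =>
    Σ S : {S : Finset (Fin K) // S ∈ Finset.univ.powersetCard (r + 1) ∧ s ∈ S}, Fin (ℓ S.1)
  let terms : (s : Fin K) → M s → Finset ((Fin n × Fin n) × Fin T) := fun s x =>
    Finset.univ.filter fun q => needed q.1 ∧ cls q.1 = x.1.1 ∧ φ q = (s, (x.2 : ℕ))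
  have hterms : ∀ s x q, q ∈ terms s x ↔
      needed q.1 ∧ cls q.1 = x.1.1 ∧ φ q = (s, (x.2 : ℕ)) := fun s x q => by simp [terms]
  -- Addition in `Bool` is XOR.
  let enc : ∀ k, (Fin n × Fin n → Word T) → M k → Bool := fun s v x =>
    ∑ q ∈ terms s x, v q.1 q.2
  have hscheme : ∃ S : ShuffleScheme G A T, ∀ k, S.len k = Fintype.card (M k) := by
    refine exists_shuffleScheme enc ?_ ?_
    · intro s v v' hv
      funext x
      refine Finset.sum_congr rfl fun q hq => ?_
      obtain ⟨h1, -, h3⟩ := (hterms _ _ _).1 hq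
      have h4 := (hφ q h1).1
      rw [h3] at h4
      rw [hv q.1 ⟨h1.1, (hf _ _).1 h4⟩]
    · intro k v v' hv hm p hp
      have hpk : own p.1 = k := (huniq _ _ hp.2.1).symm
      have hpn : needed p := ⟨hp.1, fun h => hp.2.2 ((hf _ _).1 (hpk ▸ h))⟩
      funext b
      have hs := hφ (p, b) hpn
      set s := (φ (p, b)).1 with hsdef
      have hsk : s ≠ k := by
        intro h
        exact hpn.2 (by rw [hpk, ← h]; exact hs.1)
      let x : M s := ⟨⟨cls p, by simp [hcls p hpn], Finset.mem_insert_of_mem hs.1⟩,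
        ⟨(φ (p, b)).2, hs.2⟩⟩
      have hpx : (p, b) ∈ terms s x := (hterms _ _ _).2 ⟨hpn, rfl, rfl⟩
      have hsum : ∑ q ∈ terms s x, v q.1 q.2 = ∑ q ∈ terms s x, v' q.1 q.2 :=
        congrFun (hm s hsk) x
      rw [← Finset.add_sum_erase _ _ hpx, ← Finset.add_sum_erase _ _ hpx] at hsum
      have hrest : ∑ q ∈ (terms s x).erase (p, b), v q.1 q.2
          = ∑ q ∈ (terms s x).erase (p, b), v' q.1 q.2 := by
        refine Finset.sum_congr rfl fun q hq => ?_
        obtain ⟨hne, hq⟩ := Finset.mem_erase.1 hq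
        obtain ⟨h1, h2, h3⟩ := (hterms _ _ _).1 hq
        -- By injectivity of the slot assignment, a sum contains at most one bit destined for `k`;
        -- every other summand has `k` in its group but not as Reducer, so `k` has Mapped it.
        have hok : own q.1.1 ≠ k := by
          intro h
          exact hne (hinj q (p, b) h1 hpn (h.trans hpk.symm) h2 h3)
        have hkq : k ∈ cls q.1 := by
          rw [h2]
          exact hpk ▸ Finset.mem_insert_self _ _
        have hkf : k ∈ f q.1.2 := (Finset.mem_insert.1 hkq).resolve_left fun h => hok h.symm
        rw [hv q.1 ⟨h1.1, (hf _ _).1 hkf⟩]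
      rw [hrest] at hsum
      exact add_right_cancel hsum
  obtain ⟨S, hS⟩ := hscheme
  refine ⟨S, ?_⟩
  simp only [hS, M, Fintype.card_sigma, Fintype.card_fin]
  have h1 : ∀ s : Fin K, ∑ S : {S : Finset (Fin K) // S ∈ Finset.univ.powersetCard (r + 1) ∧ s ∈ S},
      ℓ S.1 = ∑ S ∈ Finset.univ.powersetCard (r + 1), if s ∈ S then ℓ S else 0 := by
    intro s
    rw [← Finset.sum_filter]
    exact (Finset.sum_subtype _ (fun S => by simp) ℓ).symm
  -- Double counting: each S is charged once by each of its r + 1 members.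
  rw [Finset.sum_congr rfl fun s _ => h1 s, Finset.sum_comm]
  refine Finset.sum_congr rfl fun S hS => ?_
  rw [Finset.sum_ite_mem, Finset.univ_inter, Finset.sum_const, (Finset.mem_powersetCard.1 hS).2,
    smul_eq_mul]

lemma normalizedLoad_eq_ofReal (hn : 0 < n) (hT : 0 < T) (b : ℕ) :
    normalizedLoad n T b = ENNReal.ofReal ((b : ℝ) / ((n : ℝ) ^ 2 * T)) := by
  rw [normalizedLoad, ENNReal.ofReal_div_of_pos (by positivity), ENNReal.ofReal_natCast,
    ENNReal.ofReal_mul (by positivity), ENNReal.ofReal_pow (by positivity), ENNReal.ofReal_natCast,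
    ENNReal.ofReal_natCast]

/-- The load of the coded Shuffling scheme. -/
theorem minLoad_le_coded {G : LoopGraph n} {A : Allocation n K r} (hn : 0 < n) (hT : 0 < T)
    (hr : 1 ≤ r) (f : Fin n → Finset (Fin K)) (hf : ∀ j k, k ∈ f j ↔ j ∈ A.map k)
    (hcard : ∀ j, (f j).card = r) (N : Finset (Fin K) → ℕ)
    (hN : ∀ S : Finset (Fin K), S.card = r + 1 → ∀ k ∈ S,
      (edgesBetween G (A.reduce k) (batch f (S.erase k))).card ≤ N S) :
    minLoad T A G ≤ ENNReal.ofReal (((r : ℝ) + 1) / r *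
      (∑ S ∈ (Finset.univ : Finset (Fin K)).powersetCard (r + 1), ((N S : ℝ) + r)) / (n : ℝ) ^ 2) := by
  obtain ⟨S, hS⟩ := exists_coded_shuffleScheme (G := G) (A := A) (T := T) f hf hcard
    -- The `+ 1` rounds the quotient up; since T ≥ 1 it costs no more than replacing `N S` by `N S +
    -- r`, whence the additive `r` in the bound.
    (fun S => N S * T / r + 1) (fun S hS k hk => by
      have h1 := Nat.mul_le_mul_right T (hN S hS k hk)
      have h2 := Nat.lt_mul_div_succ (N S * T) hr
      exact h1.trans h2.le)
  refine (iInf_le _ S).trans ?_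
  rw [normalizedLoad_eq_ofReal hn hT]
  refine ENNReal.ofReal_le_ofReal ?_
  have hT' : (0 : ℝ) < T := by exact_mod_cast hT
  have hn' : (0 : ℝ) < n := by exact_mod_cast hn
  have hr' : (0 : ℝ) < r := by exact_mod_cast hr
  rw [div_le_div_iff₀ (by positivity) (by positivity), hS]
  have key : ((∑ S ∈ (Finset.univ : Finset (Fin K)).powersetCard (r + 1),
      (r + 1) * (N S * T / r + 1) : ℕ) : ℝ) ≤ ((r : ℝ) + 1) / r *
      (∑ S ∈ (Finset.univ : Finset (Fin K)).powersetCard (r + 1), ((N S : ℝ) + r)) * T := by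
    push_cast
    rw [Finset.mul_sum, Finset.sum_mul]
    refine Finset.sum_le_sum fun S _ => ?_
    have h1 : ((N S * T / r : ℕ) : ℝ) ≤ (N S : ℝ) * T / r := by
      have := @Nat.cast_div_le ℝ _ _ _ (N S * T) r
      push_cast at this
      exact this
    have hT1 : (1 : ℝ) ≤ T := by exact_mod_cast hT
    have h2 : (N S : ℝ) * T / r + 1 ≤ ((N S : ℝ) + r) * T / r := by
      rw [add_mul, add_div, mul_div_assoc (r : ℝ), mul_div_left_comm, div_self hr'.ne', mul_one]
      linarith
    calc ((r : ℝ) + 1) * (((N S * T / r : ℕ) : ℝ) + 1)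
        ≤ ((r : ℝ) + 1) * (((N S : ℝ) + r) * T / r) := by gcongr; linarith
      _ = _ := by ring
  calc _ ≤ _ := mul_le_mul_of_nonneg_right key (by positivity)
    _ = _ := by ring

end Schemes

/-! ### Batched allocations -/

section Allocations

variable {K r : ℕ}

/-- Sets of size `r` can be chosen one after the other so that all points are covered equally
often, up to one. -/
lemma exists_balanced_sets (hrK : r ≤ K) (s : ℕ) :
    ∃ g : Fin s → Finset (Fin K), (∀ t, (g t).card = r) ∧
      ∀ k l, (Finset.univ.filter fun t => k ∈ g t).card
        ≤ (Finset.univ.filter fun t => l ∈ g t).card + 1 := by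
  classical
  induction s with
  | zero => exact ⟨fun t => t.elim0, fun t => t.elim0, fun k l => by simp⟩
  | succ s ih =>
    obtain ⟨g, hg, hb⟩ := ih
    set c : Fin K → ℕ := fun k => (Finset.univ.filter fun t => k ∈ g t).card with hc
    obtain ⟨U, hU, hU'⟩ : ∃ U : Finset (Fin K), U.card = r ∧
        ∀ k l, c k + (if k ∈ U then 1 else 0) ≤ c l + (if l ∈ U then 1 else 0) + 1 := by
      rcases Nat.eq_zero_or_pos K with rfl | hK
      · exact ⟨∅, by simp; omega, fun k => k.elim0⟩
      obtain ⟨k₀, -, hk₀⟩ := Finset.exists_min_image (Finset.univ : Finset (Fin K)) c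
        ⟨⟨0, hK⟩, Finset.mem_univ _⟩
      -- The counts take at most the two values `c k₀` and `c k₀ + 1`. The new set is drawn from the
      -- lower level `L`, and leaves it only after exhausting it, so the gap stays at most one.
      let L := Finset.univ.filter fun k => c k = c k₀
      have hL : ∀ k, k ∈ L ↔ c k = c k₀ := fun k => by simp [L]
      have h1 : ∀ k, k ∉ L → c k = c k₀ + 1 := fun k hk => by
        have h2 := hk₀ k (Finset.mem_univ _)
        have h3 := hb k k₀
        have h4 : c k ≠ c k₀ := fun h => hk ((hL k).2 h)
        change c k ≤ c k₀ + 1 at h3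
        omega
      rcases le_total r L.card with h | h
      · obtain ⟨U, hUL, hU⟩ := Finset.exists_subset_card_eq h
        refine ⟨U, hU, fun k l => ?_⟩
        have hk : k ∈ U → c k = c k₀ := fun h => (hL k).1 (hUL h)
        have hk' : c k ≤ c k₀ + 1 := hb k k₀
        have hl := hk₀ l (Finset.mem_univ _)
        split_ifs with h3 h4 h4
        · have := hk h3; omega
        · have := hk h3; omega
        · omega
        · omega
      · obtain ⟨U, hLU, -, hU⟩ := Finset.exists_subsuperset_card_eq (Finset.subset_univ L) h
          (by simpa using hrK)
        refine ⟨U, hU, fun k l => ?_⟩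
        have hk' : c k ≤ c k₀ + 1 := hb k k₀
        have hl := hk₀ l (Finset.mem_univ _)
        have hl' : l ∉ U → c l = c k₀ + 1 := fun h => h1 l fun h' => h (hLU h')
        split_ifs with h3 h4 h4
        · omega
        · have := hl' h4; omega
        · omega
        · have := hl' h4; omega
    refine ⟨Fin.cons U g, ?_, ?_⟩
    · intro t
      induction t using Fin.cases with
      | zero => simpa using hU
      | succ t => simpa using hg t
    · have h1 : ∀ k, (Finset.univ.filter fun t : Fin (s + 1) =>
          k ∈ (Fin.cons U g : Fin (s + 1) → Finset (Fin K)) t).card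
          = c k + (if k ∈ U then 1 else 0) := by
        intro k
        simp only [hc, Finset.card_filter, Fin.sum_univ_succ, Fin.cons_zero, Fin.cons_succ]
        rw [add_comm]
      intro k l
      rw [h1, h1]
      exact hU' k l

/-- The number of sets of size `r` that contain a given point does not depend on the point. -/
lemma card_powersetCard_mem_eq (k l : Fin K) :
    (((Finset.univ : Finset (Fin K)).powersetCard r).filter fun S => k ∈ S).card
      = (((Finset.univ : Finset (Fin K)).powersetCard r).filter fun S => l ∈ S).card := by
  classical
  refine Finset.card_bij' (fun S _ => S.map (Equiv.swap k l).toEmbedding)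
    (fun S _ => S.map (Equiv.swap k l).toEmbedding) ?_ ?_ ?_ ?_
  · intro S hS
    simp only [Finset.mem_filter, Finset.mem_powersetCard, Finset.subset_univ, true_and,
      Finset.card_map] at hS ⊢
    exact ⟨hS.1, Finset.mem_map.2 ⟨k, hS.2, by simp⟩⟩
  · intro S hS
    simp only [Finset.mem_filter, Finset.mem_powersetCard, Finset.subset_univ, true_and,
      Finset.card_map] at hS ⊢
    exact ⟨hS.1, Finset.mem_map.2 ⟨l, hS.2, by simp⟩⟩
  · intro S _
    ext x
    simp
  · intro S _
    ext x
    simp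

/-- Sets of size `r` can be assigned to `n` points so that all machines are covered equally often,
up to one, and every set is used about equally often. -/
lemma exists_balanced_batches (hrK : r ≤ K) (n : ℕ) :
    ∃ f : Fin n → Finset (Fin K), (∀ j, (f j).card = r) ∧
      (∀ k l, (Finset.univ.filter fun j => k ∈ f j).card
        ≤ (Finset.univ.filter fun j => l ∈ f j).card + 1) ∧
      ∀ S, (batch f S).card ≤ n / K.choose r + K.choose r := by
  classical
  set C := K.choose r with hC
  have hCpos : 0 < C := Nat.choose_pos hrK
  obtain ⟨g, hg, hgb⟩ := exists_balanced_sets hrK (n % C)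
  -- Split n = C · (n / C) + n % C: each r-set is used n / C times, and the remaining n % C points
  -- receive the balanced sets `g`.
  let P := {S : Finset (Fin K) // S ∈ (Finset.univ : Finset (Fin K)).powersetCard r}
  have hP : Fintype.card P = C := by
    rw [Fintype.card_coe, Finset.card_powersetCard, Finset.card_univ, Fintype.card_fin]
  have hcardn : Fintype.card (Fin n) = Fintype.card ((P × Fin (n / C)) ⊕ Fin (n % C)) := by
    rw [Fintype.card_sum, Fintype.card_prod, hP, Fintype.card_fin, Fintype.card_fin,
      Fintype.card_fin, Nat.div_add_mod]
  let e := Fintype.equivOfCardEq hcardn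
  let f' : (P × Fin (n / C)) ⊕ Fin (n % C) → Finset (Fin K) :=
    Sum.elim (fun x => x.1.1) g
  have hcount : ∀ (p : Finset (Fin K) → Prop) [DecidablePred p],
      (Finset.univ.filter fun j => p (f' (e j))).card
        = (Finset.univ.filter fun x : P => p x.1).card * (n / C)
          + (Finset.univ.filter fun t => p (g t)).card := by
    intro p _
    rw [Finset.card_filter, Equiv.sum_comp e (fun y => if p (f' y) then 1 else 0),
      Fintype.sum_sum_type, Fintype.sum_prod_type]
    change ∑ x : P, ∑ _y : Fin (n / C), (if p x.1 then 1 else 0) +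
      ∑ t, (if p (g t) then 1 else 0) = _
    rw [Finset.card_filter, Finset.card_filter, Finset.sum_mul]
    congr 1
    refine Finset.sum_congr rfl fun x _ => ?_
    rw [Finset.sum_const, Finset.card_univ, Fintype.card_fin, smul_eq_mul, mul_comm]
  refine ⟨fun j => f' (e j), ?_, ?_, ?_⟩
  · intro j
    change (f' (e j)).card = r
    rcases e j with x | t
    · exact (Finset.mem_powersetCard.1 x.1.2).2
    · exact hg t
  · intro k l
    have hk := hcount fun S => k ∈ S
    have hl := hcount fun S => l ∈ S
    have h1 : ∀ k : Fin K, (Finset.univ.filter fun x : P => k ∈ x.1).card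
        = (((Finset.univ : Finset (Fin K)).powersetCard r).filter fun S => k ∈ S).card := by
      intro k
      rw [Finset.card_filter, Finset.card_filter]
      exact Finset.sum_coe_sort _ (fun S : Finset (Fin K) => if k ∈ S then 1 else 0)
    -- The full rounds load all machines equally, so only the remainder can create imbalance.
    rw [h1, card_powersetCard_mem_eq k l] at hk
    rw [h1] at hl
    have := hgb k l
    beta_reduce
    omega
  · intro S
    have h2 := hcount fun S' => S' = S
    have h3 : (Finset.univ.filter fun x : P => x.1 = S).card ≤ 1 :=
      Finset.card_le_one.2 fun a ha b hb => Subtype.ext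
        ((Finset.mem_filter.1 ha).2.trans (Finset.mem_filter.1 hb).2.symm)
    have h4 : (Finset.univ.filter fun t => g t = S).card ≤ n % C :=
      (Finset.card_filter_le _ _).trans (by simp)
    have h5 : n % C < C := Nat.mod_lt _ hCpos
    have h6 : (Finset.univ.filter fun x : P => x.1 = S).card * (n / C) ≤ 1 * (n / C) :=
      Nat.mul_le_mul_right _ h3
    change (Finset.univ.filter fun j => f' (e j) = S).card ≤ _
    omega

/-- Summing `|{t | k ∈ g t}|` over all `k` counts the points of all the sets `g t`. -/
lemma sum_card_filter_mem {n : ℕ} (g : Fin n → Finset (Fin K)) {c : ℕ} (hg : ∀ t, (g t).card = c) :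
    ∑ k, (Finset.univ.filter fun t => k ∈ g t).card = c * n := by
  classical
  simp_rw [Finset.card_filter]
  rw [Finset.sum_comm]
  simp [hg, mul_comm]

/-- If the values of `c` differ by at most one, each is within one of their average. -/
lemma abs_sub_average_le_one {c : Fin K → ℕ} (hc : ∀ k l, c k ≤ c l + 1) (k : Fin K) :
    |(c k : ℝ) - (∑ l, c l : ℕ) / K| ≤ 1 := by
  have hK : (0 : ℝ) < K := by exact_mod_cast k.pos
  have h1 : (K : ℝ) * c k ≤ (∑ l, c l : ℕ) + K := by
    have : ∑ _l : Fin K, c k ≤ ∑ l, (c l + 1) := Finset.sum_le_sum fun l _ => hc k l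
    simp only [Finset.sum_const, Finset.card_univ, Fintype.card_fin, smul_eq_mul,
      Finset.sum_add_distrib, mul_one] at this
    exact_mod_cast this
  have h2 : ((∑ l, c l : ℕ) : ℝ) ≤ K * c k + K := by
    have : ∑ l, c l ≤ ∑ _l : Fin K, (c k + 1) := Finset.sum_le_sum fun l _ => hc l k
    simp only [Finset.sum_const, Finset.card_univ, Fintype.card_fin, smul_eq_mul, mul_add,
      mul_one] at this
    exact_mod_cast this
  rw [abs_le]
  constructor
  · have : ((∑ l, c l : ℕ) : ℝ) / K ≤ c k + 1 := by
      rw [div_le_iff₀ hK]; linarith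
    linarith
  · have : (c k : ℝ) - 1 ≤ ((∑ l, c l : ℕ) : ℝ) / K := by
      rw [le_div_iff₀ hK]; linarith
    linarith

/-- The allocation in which every set of `r` machines Maps a batch of about `n / K.choose r`
vertices. -/
theorem exists_batched_allocation (hr : 1 ≤ r) (hrK : r ≤ K) (n : ℕ) :
    ∃ (A : Allocation n K r) (f : Fin n → Finset (Fin K)),
      (∀ j k, k ∈ f j ↔ j ∈ A.map k) ∧ (∀ j, (f j).card = r) ∧
      (∀ k, ((A.reduce k).card : ℝ) ≤ n / K + 1) ∧
      ∀ S, ((batch f S).card : ℝ) ≤ n / K.choose r + K.choose r := by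
  classical
  obtain ⟨f, hf, hfb, hfs⟩ := exists_balanced_batches hrK n
  -- Balanced sets of size one amount to a balanced partition, used for Reducing.
  obtain ⟨g, hg, hgb⟩ := exists_balanced_sets (hr.trans hrK) n
  refine ⟨{ map := fun k => Finset.univ.filter fun j => k ∈ f j
            reduce := fun k => Finset.univ.filter fun i => k ∈ g i
            map_cover := fun i => ?_
            map_load := sum_card_filter_mem f hf
            map_equal := hfb
            reduce_partition := fun i => ?_
            reduce_equal := hgb }, f, fun j k => by simp, hf, fun k => ?_, fun S => ?_⟩
  · have : (f i).Nonempty := Finset.card_pos.1 (by rw [hf]; omega)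
    obtain ⟨k, hk⟩ := this
    exact ⟨k, by simpa using hk⟩
  · obtain ⟨k, hk⟩ := Finset.card_eq_one.1 (hg i)
    exact ⟨k, by simp [hk], fun l hl => by simpa [hk] using hl⟩
  · have := (abs_le.1 (abs_sub_average_le_one hgb k)).2
    rw [sum_card_filter_mem g hg, one_mul] at this
    change ((Finset.univ.filter fun i => k ∈ g i).card : ℝ) ≤ _
    linarith
  · refine (Nat.cast_le.2 (hfs S)).trans ?_
    push_cast
    gcongr
    exact Nat.cast_div_le

end Allocations

/-! ### The law of large numbers in mean, uniformly over sets of coordinates -/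

section LawOfLargeNumbers

/-- The mean absolute deviation in terms of the variance. -/
lemma integral_abs_sub_integral_le {Ω : Type*} [MeasurableSpace Ω] {μ : Measure Ω}
    [IsProbabilityMeasure μ] {X : Ω → ℝ} (hX : MemLp X 2 μ) {a : ℝ} (ha : 0 < a) :
    ∫ ω, |X ω - ∫ ω', X ω' ∂μ| ∂μ ≤ Var[X; μ] / a + a := by
  have hXm : MemLp (fun ω => X ω - ∫ ω', X ω' ∂μ) 2 μ := hX.sub (memLp_const _)
  have hint : Integrable (fun ω => (X ω - ∫ ω', X ω' ∂μ) ^ 2) μ := hXm.integrable_sq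
  rw [variance_eq_integral hX.aemeasurable]
  calc ∫ ω, |X ω - ∫ ω', X ω' ∂μ| ∂μ
      ≤ ∫ ω, ((X ω - ∫ ω', X ω' ∂μ) ^ 2 / a + a) ∂μ := by
        refine integral_mono ?_ ?_ fun ω => ?_
        · exact (hXm.integrable one_le_two).abs
        · exact (hint.div_const a).add (integrable_const a)
        · set y := X ω - ∫ ω', X ω' ∂μ
          change |y| ≤ y ^ 2 / a + a
          -- Completing the square gives |y| ≤ y²/a + a with `a` free. Taking `a` to be a small
          -- multiple of n turns a variance of order n into a bound that is a small multiple of n.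
          rw [← sub_nonneg]
          have h1 : y ^ 2 / a + a - |y| = ((|y| - a / 2) ^ 2 + 3 / 4 * a ^ 2) / a := by
            rw [← sq_abs y]
            field_simp
            ring
          rw [h1]
          positivity
    _ = _ := by
        rw [integral_add (hint.div_const a) (integrable_const a), integral_div]
        simp

variable {ν : Measure ℝ} [IsProbabilityMeasure ν]

lemma integrable_coord (hν : Integrable id ν) {n : ℕ} (i : Fin n) :
    Integrable (fun d : Fin n → ℝ => d i) (Measure.pi fun _ => ν) :=
  integrable_comp_eval (f := id) hν

lemma integrable_sum_coord (hν : Integrable id ν) {n : ℕ} (S : Finset (Fin n)) :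
    Integrable (fun d : Fin n → ℝ => ∑ i ∈ S, d i) (Measure.pi fun _ => ν) :=
  integrable_finsetSum _ fun i _ => integrable_coord hν i

lemma integral_sum_coord (hν : Integrable id ν) {n : ℕ} (S : Finset (Fin n)) :
    ∫ d : Fin n → ℝ, ∑ i ∈ S, d i ∂(Measure.pi fun _ => ν) = S.card * ∫ x, x ∂ν := by
  rw [integral_finsetSum _ fun i _ => integrable_coord hν i]
  simp [integral_eval]

/-- The weak law of large numbers in mean, for bounded functions of the coordinates. -/
lemma integral_abs_sum_comp_coord_le {g : ℝ → ℝ} (hg : MemLp g 2 ν) {n : ℕ} (S : Finset (Fin n))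
    {a : ℝ} (ha : 0 < a) :
    ∫ d : Fin n → ℝ, |∑ i ∈ S, (g (d i) - ∫ x, g x ∂ν)| ∂(Measure.pi fun _ => ν)
      ≤ n * Var[g; ν] / a + a := by
  classical
  have hgi := hg.integrable one_le_two
  -- Zero summands off `S` turn the sum into one over all coordinates of the product space, as
  -- `variance_sum_pi` expects.
  let X : Fin n → ℝ → ℝ := fun i => if i ∈ S then g else 0
  have hX : ∀ i, MemLp (X i) 2 ν := fun i => by
    by_cases h : i ∈ S <;> simp [X, h, hg]
  have hsum : (∑ i, fun d : Fin n → ℝ => X i (d i)) = fun d => ∑ i ∈ S, g (d i) := by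
    funext d
    have h : ∀ i, X i (d i) = if i ∈ S then g (d i) else 0 := fun i => by
      by_cases h : i ∈ S <;> simp [X, h]
    simp [h, Finset.sum_ite_mem]
  have hvar : Var[fun d : Fin n → ℝ => ∑ i ∈ S, g (d i); Measure.pi fun _ => ν] ≤ n * Var[g; ν] := by
    rw [← hsum, variance_sum_pi hX]
    calc ∑ i, Var[X i; ν] ≤ ∑ _i : Fin n, Var[g; ν] := by
          refine Finset.sum_le_sum fun i _ => ?_
          by_cases h : i ∈ S
          · simp [X, h]
          · simp [X, h, variance_nonneg]
      _ = _ := by simp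
  have hmem : MemLp (fun d : Fin n → ℝ => ∑ i ∈ S, g (d i)) 2 (Measure.pi fun _ => ν) :=
    memLp_finsetSum _ fun i _ =>
      hg.comp_measurePreserving (measurePreserving_eval (fun _ : Fin n => ν) i)
  have hmean : ∫ d : Fin n → ℝ, ∑ i ∈ S, g (d i) ∂(Measure.pi fun _ => ν)
      = ∑ _i ∈ S, ∫ x, g x ∂ν := by
    rw [integral_finsetSum _ fun i _ => integrable_comp_eval hgi]
    exact Finset.sum_congr rfl fun i _ =>
      integral_comp_eval (μ := fun _ : Fin n => ν) hgi.aestronglyMeasurable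
  have h := integral_abs_sub_integral_le hmem ha
  rw [hmean] at h
  simp_rw [Finset.sum_sub_distrib]
  refine h.trans ?_
  gcongr

/-- The law of large numbers in mean, uniformly over all sets of coordinates. -/
theorem eventually_integral_abs_sum_sub_le (hν : Integrable id ν) {δ : ℝ} (hδ : 0 < δ) :
    ∀ᶠ n : ℕ in atTop, ∀ S : Finset (Fin n),
      ∫ d : Fin n → ℝ, |∑ i ∈ S, d i - S.card * ∫ x, x ∂ν| ∂(Measure.pi fun _ => ν) ≤ δ * n := by
  -- Only a first moment is available, so the identity is replaced by a bounded `g` close in L¹. The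
  -- fluctuation parameter, the L¹ error and the shift of the mean each cost at most δn/4; the
  -- variance term is bounded and fits in the last quarter for large n. Only |S| ≤ n enters, hence
  -- the uniformity in `S`.
  obtain ⟨g, hg, hgi⟩ := hν.exists_boundedContinuous_integral_sub_le (ε := δ / 4) (by positivity)
  have hg2 : MemLp g 2 ν := MemLp.of_bound hgi.aestronglyMeasurable ‖g‖
    (ae_of_all _ g.norm_coe_le_norm)
  have hsub : Integrable (fun x => |x - g x|) ν := (hν.sub hgi).abs
  have hm : |(∫ x, g x ∂ν) - ∫ x, x ∂ν| ≤ δ / 4 := by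
    rw [abs_sub_comm]
    have h1 : (∫ x, x ∂ν) - ∫ x, g x ∂ν = ∫ x, (x - g x) ∂ν := (integral_sub hν hgi).symm
    rw [h1]
    exact (abs_integral_le_integral_abs).trans hg
  have hlarge : ∀ᶠ n : ℕ in atTop, 4 * Var[g; ν] / δ ≤ δ / 4 * n ∧ 0 < n := by
    refine Filter.Eventually.and ?_ (eventually_gt_atTop 0)
    exact (tendsto_natCast_atTop_atTop.const_mul_atTop (by positivity)).eventually_ge_atTop _
  filter_upwards [hlarge] with n hn S
  have hn0 : (0 : ℝ) < n := by exact_mod_cast hn.2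
  have hcard : (S.card : ℝ) ≤ n := by exact_mod_cast (Finset.card_le_univ S).trans (by simp)
  have h1 := integral_abs_sum_comp_coord_le hg2 S (a := δ / 4 * n) (by positivity)
  have hgc : ∀ i : Fin n, Integrable (fun d : Fin n → ℝ => g (d i)) (Measure.pi fun _ => ν) :=
    fun i => integrable_comp_eval hgi
  have hsc : ∀ i : Fin n, Integrable (fun d : Fin n → ℝ => |d i - g (d i)|)
      (Measure.pi fun _ => ν) := fun i =>
    integrable_comp_eval (μ := fun _ : Fin n => ν) (f := fun x => |x - g x|) hsub
  have hI1 : Integrable (fun d : Fin n → ℝ => |∑ i ∈ S, (g (d i) - ∫ x, g x ∂ν)|)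
      (Measure.pi fun _ => ν) :=
    (integrable_finsetSum _ fun i _ => (hgc i).sub (integrable_const _)).abs
  have hI2 : Integrable (fun d : Fin n → ℝ => ∑ i ∈ S, |d i - g (d i)|)
      (Measure.pi fun _ => ν) := integrable_finsetSum _ fun i _ => hsc i
  have hI3 : Integrable (fun d : Fin n → ℝ =>
      |∑ i ∈ S, (g (d i) - ∫ x, g x ∂ν)| + ∑ i ∈ S, |d i - g (d i)|) (Measure.pi fun _ => ν) :=
    hI1.add hI2
  calc ∫ d : Fin n → ℝ, |∑ i ∈ S, d i - S.card * ∫ x, x ∂ν| ∂(Measure.pi fun _ => ν)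
      ≤ ∫ d : Fin n → ℝ, (|∑ i ∈ S, (g (d i) - ∫ x, g x ∂ν)| + ∑ i ∈ S, |d i - g (d i)|
          + S.card * (δ / 4)) ∂(Measure.pi fun _ => ν) := by
        refine integral_mono ?_ ?_ fun d => ?_
        · exact ((integrable_sum_coord hν S).sub (integrable_const _)).abs
        · exact hI3.add (integrable_const _)
        · have h2 : ∑ i ∈ S, d i - S.card * ∫ x, x ∂ν
              = ∑ i ∈ S, (g (d i) - ∫ x, g x ∂ν) + ∑ i ∈ S, (d i - g (d i))
                + S.card * ((∫ x, g x ∂ν) - ∫ x, x ∂ν) := by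
            simp only [Finset.sum_sub_distrib, Finset.sum_const, nsmul_eq_mul]
            ring
          simp only
          rw [h2]
          refine (abs_add_le _ _).trans (add_le_add ((abs_add_le _ _).trans
            (add_le_add le_rfl (Finset.abs_sum_le_sum_abs _ _))) ?_)
          rw [abs_mul, Nat.abs_cast]
          gcongr
    _ = ∫ d : Fin n → ℝ, |∑ i ∈ S, (g (d i) - ∫ x, g x ∂ν)| ∂(Measure.pi fun _ => ν)
        + S.card * ∫ x, |x - g x| ∂ν + S.card * (δ / 4) := by
        rw [integral_add hI3 (integrable_const _), integral_add hI1 hI2,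
          integral_finsetSum _ fun i _ => hsc i]
        have h3 : ∀ i ∈ S, ∫ d : Fin n → ℝ, |d i - g (d i)| ∂(Measure.pi fun _ => ν)
            = ∫ x, |x - g x| ∂ν := fun i _ =>
          integral_comp_eval (μ := fun _ : Fin n => ν) (f := fun x => |x - g x|)
            hsub.aestronglyMeasurable
        rw [Finset.sum_congr rfl h3]
        simp
    _ ≤ (n * Var[g; ν] / (δ / 4 * n) + δ / 4 * n) + n * (δ / 4) + n * (δ / 4) := by
        have h4 : ∫ x, |x - g x| ∂ν ≤ δ / 4 := hg
        have h5 : 0 ≤ ∫ x, |x - g x| ∂ν := integral_nonneg fun _ => abs_nonneg _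
        gcongr
    _ = 4 * Var[g; ν] / δ + 3 * (δ / 4 * n) := by field_simp; ring
    _ ≤ δ * n := by linarith [hn.1]

end LawOfLargeNumbers

/-! ### Pareto distribution -/

section Pareto

lemma measurable_paretoPDF (a : ℝ) : Measurable (paretoPDF 1 a) :=
  (measurable_paretoPDFReal 1 a).ennreal_ofReal

lemma ae_one_le_pareto (a : ℝ) : ∀ᵐ x ∂(paretoMeasure 1 a), 1 ≤ x := by
  rw [paretoMeasure, ae_withDensity_iff (measurable_paretoPDF a)]
  refine ae_of_all _ fun x hx => ?_
  by_contra h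
  exact hx (paretoPDF_of_lt (not_le.1 h))

lemma toReal_paretoPDF_smul {a : ℝ} (ha : 1 < a) :
    (fun x : ℝ => (paretoPDF 1 a x).toReal • x)
      = (Set.Ici 1).indicator fun x : ℝ => a * x ^ (-a) := by
  funext x
  rw [paretoPDF, ENNReal.toReal_ofReal (paretoPDFReal_nonneg zero_le_one (by linarith) x),
    paretoPDFReal]
  by_cases hx : 1 ≤ x
  · rw [if_pos hx, Set.indicator_of_mem (show x ∈ Set.Ici 1 from hx), Real.one_rpow, smul_eq_mul,
      mul_one, mul_assoc]
    congr 1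
    have hx0 : 0 < x := by linarith
    rw [← Real.rpow_add_one hx0.ne']
    congr 1
    ring
  · rw [if_neg hx, Set.indicator_of_notMem (show x ∉ Set.Ici 1 from hx), zero_smul]

lemma integrable_id_pareto {a : ℝ} (ha : 1 < a) : Integrable id (paretoMeasure 1 a) := by
  rw [paretoMeasure, integrable_withDensity_iff_integrable_smul'
    (measurable_paretoPDF a) (ae_of_all _ fun _ => ENNReal.ofReal_lt_top)]
  simp only [id]
  rw [toReal_paretoPDF_smul ha, integrable_indicator_iff measurableSet_Ici,
    integrableOn_Ici_iff_integrableOn_Ioi]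
  exact (integrableOn_Ioi_rpow_of_lt (by linarith) one_pos).const_mul a

lemma integral_id_pareto {a : ℝ} (ha : 1 < a) : ∫ x, x ∂(paretoMeasure 1 a) = a / (a - 1) := by
  rw [paretoMeasure, integral_withDensity_eq_integral_toReal_smul
    (measurable_paretoPDF a) (ae_of_all _ fun _ => ENNReal.ofReal_lt_top),
    toReal_paretoPDF_smul ha, integral_indicator measurableSet_Ici, integral_Ici_eq_integral_Ioi,
    integral_const_mul, integral_Ioi_rpow_of_lt (by linarith) one_pos, Real.one_rpow]
  have h1 : a - 1 ≠ 0 := by linarith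
  have h2 : -a + 1 ≠ 0 := by intro h; apply h1; linarith
  field_simp
  ring

end Pareto

/-! ### Edge counts given the degrees -/

section EdgeCounts

variable {n : ℕ} {d : Fin n → ℝ}

lemma rho_nonneg (hd : ∀ i, 1 ≤ d i) : 0 ≤ rho d :=
  inv_nonneg.2 (Finset.sum_nonneg fun i _ => zero_le_one.trans (hd i))

lemma card_le_sum_of_one_le (hd : ∀ i, 1 ≤ d i) (S : Finset (Fin n)) : (S.card : ℝ) ≤ ∑ i ∈ S, d i := by
  have := Finset.card_nsmul_le_sum S d 1 fun i _ => hd i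
  simpa using this

lemma rho_mul_sum_le_one (hd : ∀ i, 1 ≤ d i) (S : Finset (Fin n)) : rho d * ∑ i ∈ S, d i ≤ 1 := by
  have h0 : 0 ≤ ∑ i, d i := Finset.sum_nonneg fun i _ => zero_le_one.trans (hd i)
  have h1 : ∑ i ∈ S, d i ≤ ∑ i, d i :=
    Finset.sum_le_sum_of_subset_of_nonneg (Finset.subset_univ S)
      fun i _ _ => zero_le_one.trans (hd i)
  rw [rho, inv_mul_eq_div]
  exact div_le_one_of_le₀ h1 h0

/-- The three degree sums are replaced by their means one at a time. Each replacement costs a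
deviation multiplied by `m` or 1 and by factors such as ρ ∑_B d, ρ|R| and |B|/n, all at most 1. The
error is therefore linear in the deviations, and L¹ control is enough. -/
lemma rho_mul_sum_mul_sum_le (hn : 0 < n) (hd : ∀ i, 1 ≤ d i) {m : ℝ} (hm : 0 ≤ m)
    (R B : Finset (Fin n)) :
    rho d * (∑ i ∈ R, d i) * ∑ j ∈ B, d j ≤ R.card * B.card * m / n
      + (m * |∑ i, d i - n * m| + |∑ i ∈ R, d i - R.card * m|
        + m * |∑ j ∈ B, d j - B.card * m|) := by
  have hn' : (0 : ℝ) < n := by exact_mod_cast hn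
  have hρ := rho_nonneg hd
  have hD : 0 < ∑ i, d i := by
    have := card_le_sum_of_one_le hd Finset.univ
    simp only [Finset.card_univ, Fintype.card_fin] at this
    linarith
  have hρD : rho d * ∑ i, d i = 1 := inv_mul_cancel₀ hD.ne'
  have hρR : rho d * R.card ≤ 1 :=
    (mul_le_mul_of_nonneg_left (card_le_sum_of_one_le hd R) hρ).trans (rho_mul_sum_le_one hd R)
  have hρB := rho_mul_sum_le_one hd B
  have hB0 : 0 ≤ ∑ j ∈ B, d j := Finset.sum_nonneg fun i _ => zero_le_one.trans (hd i)
  have hBn : (B.card : ℝ) ≤ n := by exact_mod_cast (Finset.card_le_univ B).trans (by simp)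
  set DR := ∑ i ∈ R, d i
  set DB := ∑ j ∈ B, d j
  set D := ∑ i, d i
  set ρ := rho d
  set a : ℝ := (R.card : ℝ) with ha
  set b : ℝ := (B.card : ℝ) with hb
  have ha0 : 0 ≤ a := by positivity
  have hb0 : 0 ≤ b := by positivity
  have e1 : DR ≤ a * m + |DR - a * m| := by linarith [le_abs_self (DR - a * m)]
  have e2 : DB ≤ b * m + |DB - b * m| := by linarith [le_abs_self (DB - b * m)]
  have e3 : n * m ≤ D + |D - n * m| := by linarith [neg_abs_le (D - n * m)]
  have e4 : ρ * m ≤ (1 + ρ * |D - n * m|) / n := by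
    rw [le_div_iff₀ hn']
    calc ρ * m * n = ρ * (n * m) := by ring
      _ ≤ ρ * (D + |D - n * m|) := mul_le_mul_of_nonneg_left e3 hρ
      _ = _ := by rw [mul_add, hρD]
  calc ρ * DR * DB = DR * (ρ * DB) := by ring
    _ ≤ (a * m + |DR - a * m|) * (ρ * DB) := mul_le_mul_of_nonneg_right e1 (by positivity)
    _ = ρ * a * m * DB + |DR - a * m| * (ρ * DB) := by ring
    _ ≤ ρ * a * m * (b * m + |DB - b * m|) + |DR - a * m| * 1 := by gcongr
    _ = a * b * m * (ρ * m) + ρ * a * (m * |DB - b * m|) + |DR - a * m| := by ring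
    _ ≤ a * b * m * ((1 + ρ * |D - n * m|) / n) + 1 * (m * |DB - b * m|) + |DR - a * m| := by
        gcongr
    _ = a * b * m / n + (ρ * a) * (b / n) * (m * |D - n * m|) + m * |DB - b * m|
        + |DR - a * m| := by ring
    _ ≤ a * b * m / n + 1 * 1 * (m * |D - n * m|) + m * |DB - b * m| + |DR - a * m| := by
        have : b / n ≤ 1 := (div_le_one hn').2 hBn
        gcongr
    _ = _ := by ring

lemma edgeProb_le (hd : ∀ i, 1 ≤ d i) (i j : Fin n) :
    (edgeProb d s(i, j) : ℝ) ≤ rho d * (d i * d j) := by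
  have h : 0 ≤ rho d * (d i * d j) :=
    mul_nonneg (rho_nonneg hd)
      (mul_nonneg (zero_le_one.trans (hd i)) (zero_le_one.trans (hd j)))
  rw [edgeProb, Set.coe_projIcc]
  exact max_le h (min_le_right _ _)

lemma le_edgeProb {x : ℝ} (hx : x ≤ 1) {i j : Fin n} (h : x ≤ rho d * (d i * d j)) :
    x ≤ edgeProb d s(i, j) := by
  rw [edgeProb, Set.coe_projIcc]
  exact le_max_of_le_right (le_min hx h)

lemma sum_edgeProb_le (hd : ∀ i, 1 ≤ d i) (R B : Finset (Fin n)) :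
    ∑ p ∈ R ×ˢ B, (edgeProb d s(p.1, p.2) : ℝ) ≤ rho d * (∑ i ∈ R, d i) * ∑ j ∈ B, d j := by
  calc ∑ p ∈ R ×ˢ B, (edgeProb d s(p.1, p.2) : ℝ)
      ≤ ∑ p ∈ R ×ˢ B, rho d * (d p.1 * d p.2) :=
        Finset.sum_le_sum fun p _ => edgeProb_le hd p.1 p.2
    _ = _ := by rw [← Finset.mul_sum, Finset.sum_product, ← Finset.sum_mul_sum, mul_assoc]

lemma integral_edge (d : Fin n → ℝ) (e : Sym2 (Fin n)) :
    ∫ G, (if G e = true then (1 : ℝ) else 0) ∂(edgeLaw d) = edgeProb d e := by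
  have h := integral_comp_eval (μ := fun e => bernoulliMeasure true false (edgeProb d e)) (i := e)
    (f := fun b : Bool => if b = true then (1 : ℝ) else 0)
    (Measurable.of_discrete.aestronglyMeasurable)
  rw [edgeLaw, h, integral_bernoulliMeasure]
  simp

lemma card_edgesBetween (G : LoopGraph n) (R B : Finset (Fin n)) :
    ((edgesBetween G R B).card : ℝ) = ∑ p ∈ R ×ˢ B, if G s(p.1, p.2) = true then (1 : ℝ) else 0 := by
  simp [edgesBetween]

lemma integral_card_edgesBetween (d : Fin n → ℝ) (R B : Finset (Fin n)) :
    ∫ G, ((edgesBetween G R B).card : ℝ) ∂(edgeLaw d)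
      = ∑ p ∈ R ×ˢ B, (edgeProb d s(p.1, p.2) : ℝ) := by
  simp_rw [card_edgesBetween]
  rw [integral_finsetSum _ fun _ _ => Integrable.of_finite]
  exact Finset.sum_congr rfl fun p _ => integral_edge d _

/-- An unordered pair comes from at most two ordered pairs. -/
lemma card_filter_sym2_le (P : Finset (Fin n × Fin n)) (e : Sym2 (Fin n)) :
    (P.filter fun p => s(p.1, p.2) = e).card ≤ 2 := by
  classical
  induction e with
  | h i j =>
    refine (Finset.card_le_card (t := {(i, j), (j, i)}) fun p hp => ?_).trans Finset.card_le_two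
    have := (Finset.mem_filter.1 hp).2
    rw [Sym2.eq_iff] at this
    simp only [Finset.mem_insert, Finset.mem_singleton, Prod.ext_iff]
    exact this

/-- Independence holds over unordered pairs only, so the count is written as ∑ c_e 1_e with
multiplicities c_e ≤ 2; then c_e² ≤ 2 c_e bounds the variance by twice the mean. -/
lemma variance_card_edgesBetween_le (d : Fin n → ℝ) (R B : Finset (Fin n)) :
    Var[fun G => ((edgesBetween G R B).card : ℝ); edgeLaw d]
      ≤ 2 * ∑ p ∈ R ×ˢ B, (edgeProb d s(p.1, p.2) : ℝ) := by
  classical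
  let c : Sym2 (Fin n) → ℝ := fun e => ((R ×ˢ B).filter fun p => s(p.1, p.2) = e).card
  have hc2 : ∀ e, c e ≤ 2 := fun e => by
    simp only [c]
    exact_mod_cast card_filter_sym2_le _ e
  have hc0 : ∀ e, 0 ≤ c e := fun e => Nat.cast_nonneg _
  have hfib : ∀ g : Sym2 (Fin n) → ℝ, ∑ p ∈ R ×ˢ B, g s(p.1, p.2) = ∑ e, c e * g e := by
    intro g
    rw [← Finset.sum_fiberwise (R ×ˢ B) (fun p => s(p.1, p.2))]
    refine Finset.sum_congr rfl fun e _ => ?_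
    rw [Finset.sum_congr rfl fun p hp => by rw [(Finset.mem_filter.1 hp).2], Finset.sum_const,
      nsmul_eq_mul]
  let X : Sym2 (Fin n) → Bool → ℝ := fun e b => c e * if b = true then (1 : ℝ) else 0
  have hX : ∀ e, MemLp (X e) 2 (bernoulliMeasure true false (edgeProb d e)) := fun e =>
    MemLp.of_discrete
  have hsum : (fun G : LoopGraph n => ((edgesBetween G R B).card : ℝ))
      = ∑ e, fun G : LoopGraph n => X e (G e) := by
    funext G
    rw [card_edgesBetween, hfib fun e => if G e = true then (1 : ℝ) else 0, Finset.sum_apply]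
  rw [hsum, edgeLaw, variance_sum_pi hX, hfib fun e => (edgeProb d e : ℝ), Finset.mul_sum]
  refine Finset.sum_le_sum fun e _ => ?_
  refine (variance_le_expectation_sq (hX e).aestronglyMeasurable).trans ?_
  rw [integral_bernoulliMeasure]
  have h0 : (0 : ℝ) ≤ edgeProb d e := (edgeProb d e).2.1
  simp only [X, Pi.pow_apply, if_true, Bool.false_eq_true, if_false, smul_eq_mul]
  have h1 : c e * c e ≤ 2 * c e := mul_le_mul_of_nonneg_right (hc2 e) (hc0 e)
  nlinarith

/-- Given the degrees, edge counts concentrate around their means. -/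
lemma integral_abs_card_edgesBetween_sub_le (d : Fin n → ℝ) (R B : Finset (Fin n)) {a : ℝ}
    (ha : 0 < a) :
    ∫ G, |((edgesBetween G R B).card : ℝ) - ∑ p ∈ R ×ˢ B, (edgeProb d s(p.1, p.2) : ℝ)| ∂(edgeLaw d)
      ≤ 2 * (∑ p ∈ R ×ˢ B, (edgeProb d s(p.1, p.2) : ℝ)) / a + a := by
  have h := integral_abs_sub_integral_le (μ := edgeLaw d)
    (X := fun G => ((edgesBetween G R B).card : ℝ)) MemLp.of_discrete ha
  rw [integral_card_edgesBetween] at h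
  refine h.trans ?_
  gcongr
  exact variance_card_edgesBetween_le d R B

end EdgeCounts

/-! ### Edge counts of the mixture -/

section Mixture

variable {ν : Measure ℝ}

/-- Truncation does not change the mean by much. -/
lemma tendsto_integral_min (hν : Integrable id ν) :
    Tendsto (fun M : ℕ => ∫ x, min x M ∂ν) atTop (𝓝 (∫ x, x ∂ν)) := by
  refine tendsto_integral_of_dominated_convergence (fun x => |x|)
    (fun M => (measurable_id.min measurable_const).aestronglyMeasurable) hν.abs
    (fun M => ae_of_all _ fun x => ?_) (ae_of_all _ fun x => ?_)
  · rw [Real.norm_eq_abs, abs_le]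
    have hM : (0 : ℝ) ≤ M := Nat.cast_nonneg M
    exact ⟨le_min (neg_abs_le x) ((neg_nonpos.2 (abs_nonneg x)).trans hM),
      (min_le_left _ _).trans (le_abs_self x)⟩
  · refine tendsto_const_nhds.congr' ?_
    obtain ⟨N, hN⟩ := exists_nat_ge x
    filter_upwards [eventually_ge_atTop N] with M hM
    rw [min_eq_left (hN.trans (by exact_mod_cast hM))]

lemma lintegral_mixture (n : ℕ) (f : LoopGraph n → ℝ≥0∞) :
    ∫⁻ G, f G ∂((Measure.pi fun _ => ν).bind edgeLaw)
      = ∫⁻ d : Fin n → ℝ, ∫⁻ G, f G ∂(edgeLaw d) ∂(Measure.pi fun _ => ν) :=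
  Measure.lintegral_bind measurable_edgeLaw.aemeasurable Measurable.of_discrete.aemeasurable

variable [IsProbabilityMeasure ν]

lemma ae_one_le_coord (h1 : ∀ᵐ x ∂ν, 1 ≤ x) (n : ℕ) :
    ∀ᵐ d : Fin n → ℝ ∂(Measure.pi fun _ => ν), ∀ i, 1 ≤ d i :=
  ae_all_iff.2 fun i =>
    (Measure.quasiMeasurePreserving_eval (fun _ : Fin n => ν) i).ae h1

/-- The mean excess of the number of edges between two sets of vertices over the product of their
sizes times the edge density is `o(n)`, uniformly in the sets. -/
theorem eventually_lintegral_card_edgesBetween_sub_le (hν : Integrable id ν)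
    (h1 : ∀ᵐ x ∂ν, 1 ≤ x) {δ : ℝ} (hδ : 0 < δ) :
    ∀ᶠ n : ℕ in atTop, ∀ (R B : Finset (Fin n)) (c : ℝ),
      R.card * B.card * (∫ x, x ∂ν) / n ≤ c →
      ∫⁻ G, ENNReal.ofReal ((edgesBetween G R B).card - c) ∂((Measure.pi fun _ => ν).bind edgeLaw)
        ≤ ENNReal.ofReal (δ * n) := by
  set m := ∫ x, x ∂ν with hmdef
  have hm : 0 ≤ m := integral_nonneg_of_ae (h1.mono fun x hx => zero_le_one.trans hx)
  -- The degree deviations enter with total weight 2m + 1, so this `η` makes them cost δn/4. With a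
  -- = δn/4 below, the variance term 2nm/a = 8m/δ is also at most `a` for large n.
  set η := δ / (4 * (2 * m + 1)) with hη
  have hη0 : 0 < η := by positivity
  have hlarge : ∀ᶠ n : ℕ in atTop, 8 * m / δ ≤ δ / 4 * n :=
    (tendsto_natCast_atTop_atTop.const_mul_atTop (by positivity)).eventually_ge_atTop _
  filter_upwards [hlarge, eventually_gt_atTop 0, eventually_integral_abs_sum_sub_le hν hη0]
    with n hn hn0 hL R B c hc
  have hn' : (0 : ℝ) < n := by exact_mod_cast hn0
  rw [lintegral_mixture]
  set a := δ / 4 * n with ha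
  have ha0 : 0 < a := by positivity
  let E : (Fin n → ℝ) → Finset (Fin n) → ℝ := fun d S => |∑ i ∈ S, d i - S.card * m|
  have hE : ∀ S, Integrable (fun d => E d S) (Measure.pi fun _ => ν) := fun S =>
    ((integrable_sum_coord hν S).sub (integrable_const _)).abs
  let H : (Fin n → ℝ) → ℝ := fun d => 2 * (∑ i, d i) / a + a
    + (m * E d Finset.univ + E d R + m * E d B)
  have hpt : ∀ᵐ d : Fin n → ℝ ∂(Measure.pi fun _ => ν),
      ∫⁻ G, ENNReal.ofReal ((edgesBetween G R B).card - c) ∂(edgeLaw d)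
        ≤ ENNReal.ofReal (H d) ∧ 0 ≤ H d := by
    filter_upwards [ae_one_le_coord h1 n] with d hd
    set μ := ∑ p ∈ R ×ˢ B, (edgeProb d s(p.1, p.2) : ℝ) with hμ
    have hDB : ∑ j ∈ B, d j ≤ ∑ j, d j :=
      Finset.sum_le_sum_of_subset_of_nonneg (Finset.subset_univ B)
        fun i _ _ => zero_le_one.trans (hd i)
    have hDB0 : 0 ≤ ∑ j ∈ B, d j := Finset.sum_nonneg fun i _ => zero_le_one.trans (hd i)
    -- A crude bound, of order n in mean, which suffices for the variance term; the sharp bound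
    -- `hμ2` locates the mean.
    have hμ1 : μ ≤ ∑ i, d i := by
      refine (sum_edgeProb_le hd R B).trans ?_
      calc rho d * (∑ i ∈ R, d i) * ∑ j ∈ B, d j ≤ 1 * ∑ j ∈ B, d j := by
            gcongr
            exact rho_mul_sum_le_one hd R
        _ ≤ _ := by rw [one_mul]; exact hDB
    have hμ2 : μ ≤ c + (m * E d Finset.univ + E d R + m * E d B) := by
      refine (sum_edgeProb_le hd R B).trans ((rho_mul_sum_mul_sum_le hn0 hd hm R B).trans ?_)
      simp only [E, Finset.card_univ, Fintype.card_fin]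
      gcongr
    have hE0 : 0 ≤ m * E d Finset.univ + E d R + m * E d B := by
      simp only [E]; positivity
    refine ⟨?_, ?_⟩
    · have hI : Integrable (fun G => |((edgesBetween G R B).card : ℝ) - μ|) (edgeLaw d) :=
        Integrable.of_finite
      calc ∫⁻ G, ENNReal.ofReal ((edgesBetween G R B).card - c) ∂(edgeLaw d)
          ≤ ∫⁻ G, ENNReal.ofReal (|((edgesBetween G R B).card : ℝ) - μ|
              + (m * E d Finset.univ + E d R + m * E d B)) ∂(edgeLaw d) := by
            refine lintegral_mono fun G => ENNReal.ofReal_le_ofReal ?_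
            have := le_abs_self (((edgesBetween G R B).card : ℝ) - μ)
            linarith
        _ = ENNReal.ofReal (∫ G, (|((edgesBetween G R B).card : ℝ) - μ|
              + (m * E d Finset.univ + E d R + m * E d B)) ∂(edgeLaw d)) := by
            refine (ofReal_integral_eq_lintegral_ofReal (hI.add (integrable_const _)) ?_).symm
            exact ae_of_all _ fun G => add_nonneg (abs_nonneg _) hE0
        _ ≤ ENNReal.ofReal (H d) := by
            refine ENNReal.ofReal_le_ofReal ?_
            rw [integral_add hI (integrable_const _)]
            simp only [integral_const, probReal_univ, smul_eq_mul, one_mul, H]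
            have h2 := integral_abs_card_edgesBetween_sub_le d R B ha0
            have h3 : 2 * μ / a ≤ 2 * (∑ i, d i) / a := by gcongr
            linarith
    · have : 0 ≤ ∑ i, d i := hDB0.trans hDB
      positivity
  have hI1 : Integrable (fun d : Fin n → ℝ => 2 * (∑ i, d i) / a + a) (Measure.pi fun _ => ν) :=
    (((integrable_sum_coord hν Finset.univ).const_mul 2).div_const a).add (integrable_const a)
  have hI3 : Integrable (fun d : Fin n → ℝ => m * E d Finset.univ + E d R)
      (Measure.pi fun _ => ν) := ((hE _).const_mul m).add (hE R)
  have hI2 : Integrable (fun d : Fin n → ℝ => m * E d Finset.univ + E d R + m * E d B)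
      (Measure.pi fun _ => ν) := hI3.add ((hE B).const_mul m)
  refine (lintegral_mono_ae (hpt.mono fun d hd => hd.1)).trans ?_
  have hH : Integrable H (Measure.pi fun _ => ν) := hI1.add hI2
  rw [← ofReal_integral_eq_lintegral_ofReal hH (hpt.mono fun d hd => hd.2)]
  refine ENNReal.ofReal_le_ofReal ?_
  simp only [H]
  rw [integral_add hI1 hI2, integral_add ((((integrable_sum_coord hν Finset.univ).const_mul
      2).div_const a)) (integrable_const a), integral_div, integral_const_mul,
    integral_sum_coord hν, integral_add hI3 ((hE B).const_mul m),
    integral_add ((hE _).const_mul m) (hE R), integral_const_mul m (fun d => E d Finset.univ),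
    integral_const_mul m (fun d => E d B), integral_const, probReal_univ, one_smul, Finset.card_univ, Fintype.card_fin]
  rw [← hmdef] at hL
  have e1 := mul_le_mul_of_nonneg_left (hL Finset.univ) hm
  have e2 := hL R
  have e3 := mul_le_mul_of_nonneg_left (hL B) hm
  have e4 : 2 * (n * m) / a = 8 * m / δ := by rw [ha]; field_simp; ring
  have e5 : (2 * m + 1) * (η * n) = a := by rw [hη, ha]; field_simp
  rw [e4]
  have e6 : δ * n = 4 * a := by rw [ha]; ring
  rw [e6]
  simp only [E]
  linarith

/-- The probability of an edge between two vertices is at least `(m - o(1)) / n`, uniformly. -/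
theorem eventually_le_lintegral_edge (hν : Integrable id ν) (h1 : ∀ᵐ x ∂ν, 1 ≤ x) {δ : ℝ}
    (hδ : 0 < δ) :
    ∀ᶠ n : ℕ in atTop, ∀ i j : Fin n, i ≠ j →
      ENNReal.ofReal (((∫ x, x ∂ν) - δ) / n)
        ≤ ∫⁻ G, (if G s(i, j) = true then 1 else 0) ∂((Measure.pi fun _ => ν).bind edgeLaw) := by
  set m := ∫ x, x ∂ν with hmdef
  have hm1 : 1 ≤ m := by
    have h := integral_mono_ae (integrable_const (1 : ℝ)) hν h1
    simpa using h
  have hm : 0 < m := by linarith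
  -- Degrees are truncated at `M`: for n ≥ M² the truncated product times ρ is at most M²/n ≤ 1, so
  -- the cap on edge probabilities plays no role. Half of `δ` pays for truncation.
  obtain ⟨M, hM, hM1⟩ : ∃ M : ℕ, m - δ / 2 < (∫ x, min x M ∂ν) * (∫ x, min x M ∂ν) / m ∧ 1 ≤ M := by
    have ht := tendsto_integral_min hν
    have ht2 := ((ht.mul ht).div_const m)
    rw [← hmdef, mul_div_assoc, div_self hm.ne', mul_one] at ht2
    exact ((ht2.eventually_const_lt (by linarith : m - δ / 2 < m)).and
      (eventually_ge_atTop 1)).exists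
  set t := ∫ x, min x (M : ℝ) ∂ν with htdef
  have hM0 : (1 : ℝ) ≤ M := by exact_mod_cast hM1
  -- Chosen so that M²/(mn)² · ηn = δ/(2n), the other half of `δ`.
  set η := δ * m ^ 2 / (2 * M ^ 2) with hη
  have hη0 : 0 < η := by positivity
  have hlarge : ∀ᶠ n : ℕ in atTop, (M : ℝ) ^ 2 ≤ n :=
    tendsto_natCast_atTop_atTop.eventually_ge_atTop _
  filter_upwards [hlarge, eventually_gt_atTop 0, eventually_integral_abs_sum_sub_le hν hη0]
    with n hn hn0 hL i j hij
  have hn' : (0 : ℝ) < n := by exact_mod_cast hn0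
  rw [lintegral_mixture]
  have hint : ∀ d : Fin n → ℝ, ∫⁻ G, (if G s(i, j) = true then (1 : ℝ≥0∞) else 0) ∂(edgeLaw d)
      = ENNReal.ofReal (edgeProb d s(i, j)) := by
    intro d
    rw [← integral_edge, ofReal_integral_eq_lintegral_ofReal Integrable.of_finite
      (ae_of_all _ fun G => by positivity)]
    refine lintegral_congr fun G => ?_
    split_ifs <;> simp
  simp_rw [hint]
  have hpm : Measurable fun d : Fin n → ℝ => (edgeProb d s(i, j) : ℝ) :=
    (measurable_edgeProb _).subtype_val
  have hpi : Integrable (fun d : Fin n → ℝ => (edgeProb d s(i, j) : ℝ)) (Measure.pi fun _ => ν) :=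
    (integrable_const (1 : ℝ)).mono' hpm.aestronglyMeasurable (ae_of_all _ fun d => by
      rw [Real.norm_eq_abs, abs_of_nonneg (edgeProb d _).2.1]
      exact (edgeProb d _).2.2)
  rw [← ofReal_integral_eq_lintegral_ofReal hpi (ae_of_all _ fun d => (edgeProb d _).2.1)]
  refine ENNReal.ofReal_le_ofReal ?_
  let E : (Fin n → ℝ) → ℝ := fun d => |∑ k, d k - n * m|
  have hE : Integrable E (Measure.pi fun _ => ν) :=
    ((integrable_sum_coord hν Finset.univ).sub (integrable_const _)).abs
  have hEle : ∫ d, E d ∂(Measure.pi fun _ => ν) ≤ η * n := by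
    simpa [E] using hL Finset.univ
  have hmin : Measurable fun x : ℝ => min x (M : ℝ) := measurable_id.min measurable_const
  let Y : (Fin n → ℝ) → ℝ := fun d => min (d i) M * min (d j) M
  have hYm : Measurable Y :=
    (hmin.comp (measurable_pi_apply i)).mul (hmin.comp (measurable_pi_apply j))
  have hYb : ∀ᵐ d : Fin n → ℝ ∂(Measure.pi fun _ => ν), 0 ≤ Y d ∧ Y d ≤ M ^ 2 := by
    filter_upwards [ae_one_le_coord h1 n] with d hd
    have hi : 0 ≤ min (d i) (M : ℝ) := le_min (zero_le_one.trans (hd i)) (by positivity)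
    have hj : 0 ≤ min (d j) (M : ℝ) := le_min (zero_le_one.trans (hd j)) (by positivity)
    refine ⟨mul_nonneg hi hj, ?_⟩
    rw [sq]
    exact mul_le_mul (min_le_right _ _) (min_le_right _ _) hj (by positivity)
  have hY : Integrable Y (Measure.pi fun _ => ν) :=
    (integrable_const ((M : ℝ) ^ 2)).mono' hYm.aestronglyMeasurable (hYb.mono fun d hd => by
      rw [Real.norm_eq_abs, abs_of_nonneg hd.1]; exact hd.2)
  have hYint : ∫ d, Y d ∂(Measure.pi fun _ => ν) = t * t := by
    have hind : (fun d : Fin n → ℝ => min (d i) (M : ℝ)) ⟂ᵢ[Measure.pi fun _ => ν]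
        fun d => min (d j) (M : ℝ) :=
      (iIndepFun_pi (μ := fun _ : Fin n => ν) (X := fun _ x => min x (M : ℝ))
        fun _ => hmin.aemeasurable).indepFun hij
    have h2 := hind.integral_fun_mul_eq_mul_integral
      (hmin.comp (measurable_pi_apply i)).aestronglyMeasurable
      (hmin.comp (measurable_pi_apply j)).aestronglyMeasurable
    have h3 : ∀ k : Fin n, ∫ d : Fin n → ℝ, min (d k) (M : ℝ) ∂(Measure.pi fun _ => ν) = t :=
      fun k => integral_comp_eval (μ := fun _ : Fin n => ν) (f := fun x => min x (M : ℝ))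
        hmin.aestronglyMeasurable
    rw [h3, h3] at h2
    exact h2
  have hlow : ∀ᵐ d : Fin n → ℝ ∂(Measure.pi fun _ => ν),
      Y d / (m * n) - M ^ 2 / (m * n) ^ 2 * E d ≤ edgeProb d s(i, j) := by
    filter_upwards [ae_one_le_coord h1 n, hYb] with d hd hYd
    set D := ∑ k, d k with hD
    have hDn : n ≤ D := by
      have := card_le_sum_of_one_le hd Finset.univ
      simpa using this
    have hD0 : 0 < D := hn'.trans_le hDn
    have h2 : 1 / (m * n) - E d / (m * n) ^ 2 ≤ rho d := by
      -- By convexity, 1/D lies above the tangent of the reciprocal at mn.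
      have h3 : 1 / (m * n) - (D - n * m) / (m * n) ^ 2 ≤ 1 / D := by
        rw [← sub_nonneg]
        have : 1 / D - (1 / (m * n) - (D - n * m) / (m * n) ^ 2)
            = (D - n * m) ^ 2 / (D * (m * n) ^ 2) := by
          field_simp
          ring
        rw [this]
        positivity
      have h4 : (D - n * m) / (m * n) ^ 2 ≤ E d / (m * n) ^ 2 := by
        gcongr
        exact le_abs_self _
      rw [rho, ← one_div]
      linarith
    have h5 : rho d ≤ 1 / n := by
      rw [rho, ← one_div]
      exact one_div_le_one_div_of_le hn' hDn
    have h6 : Y d / (m * n) - M ^ 2 / (m * n) ^ 2 * E d ≤ Y d * rho d := by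
      have h7 := mul_le_mul_of_nonneg_left h2 hYd.1
      have h8 : Y d * (E d / (m * n) ^ 2) ≤ M ^ 2 * (E d / (m * n) ^ 2) :=
        mul_le_mul_of_nonneg_right hYd.2 (div_nonneg (abs_nonneg _) (by positivity))
      calc Y d / (m * n) - M ^ 2 / (m * n) ^ 2 * E d
          = Y d / (m * n) - M ^ 2 * (E d / (m * n) ^ 2) := by ring
        _ ≤ Y d / (m * n) - Y d * (E d / (m * n) ^ 2) := by linarith
        _ = Y d * (1 / (m * n) - E d / (m * n) ^ 2) := by ring
        _ ≤ _ := h7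
    refine h6.trans (le_edgeProb ?_ ?_)
    · calc Y d * rho d ≤ M ^ 2 * (1 / n) :=
          mul_le_mul hYd.2 h5 (rho_nonneg hd) (by positivity)
        _ ≤ 1 := by rw [mul_one_div]; exact (div_le_one hn').2 hn
    · rw [mul_comm]
      refine mul_le_mul_of_nonneg_left ?_ (rho_nonneg hd)
      exact mul_le_mul (min_le_left _ _) (min_le_left _ _)
        (le_min (zero_le_one.trans (hd j)) (by positivity)) (zero_le_one.trans (hd i))
  have hmono := integral_mono_ae ((hY.div_const _).sub (hE.const_mul _)) hpi hlow
  refine le_trans ?_ hmono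
  simp only [Pi.sub_apply]
  rw [integral_sub (hY.div_const _) (hE.const_mul _), integral_div, integral_const_mul, hYint]
  have e1 : (M : ℝ) ^ 2 / (m * n) ^ 2 * ∫ d, E d ∂(Measure.pi fun _ => ν)
      ≤ M ^ 2 / (m * n) ^ 2 * (η * n) := mul_le_mul_of_nonneg_left hEle (by positivity)
  have e2 : (M : ℝ) ^ 2 / (m * n) ^ 2 * (η * n) = δ / 2 / n := by
    rw [hη]; field_simp
  have e3 : t * t / (m * n) = t * t / m / n := by rw [div_div]
  have e4 : (m - δ / 2) / n ≤ t * t / m / n := by gcongr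
  have e5 : (m - δ) / n = (m - δ / 2) / n - δ / 2 / n := by ring
  rw [e3, e5]
  linarith

end Mixture

/-! ### Asymptotic loads for the power law model -/

section PowerLaw

variable {γ : ℝ}

lemma integral_id_degree (hγ : 2 < γ) :
    ∫ x, x ∂(paretoMeasure 1 (γ - 1)) = (γ - 1) / (γ - 2) := by
  rw [integral_id_pareto (by linarith)]
  congr 1
  ring

lemma eventually_powerLaw_excess_le (hγ : 2 < γ) {δ : ℝ} (hδ : 0 < δ) :
    ∀ᶠ n : ℕ in atTop, ∀ (R B : Finset (Fin n)) (c : ℝ),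
      R.card * B.card * ((γ - 1) / (γ - 2)) / n ≤ c →
      ∫⁻ G, ENNReal.ofReal ((edgesBetween G R B).card - c) ∂(powerLawGraph n γ)
        ≤ ENNReal.ofReal (δ * n) := by
  have := isProbabilityMeasure_paretoMeasure one_pos (by linarith : 0 < γ - 1)
  have h := eventually_lintegral_card_edgesBetween_sub_le
    (integrable_id_pareto (by linarith : 1 < γ - 1)) (ae_one_le_pareto _) hδ
  rwa [integral_id_degree hγ] at h

lemma eventually_le_powerLaw_edge (hγ : 2 < γ) {δ : ℝ} (hδ : 0 < δ) :
    ∀ᶠ n : ℕ in atTop, ∀ i j : Fin n, i ≠ j →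
      ENNReal.ofReal (((γ - 1) / (γ - 2) - δ) / n)
        ≤ ∫⁻ G, (if G s(i, j) = true then 1 else 0) ∂(powerLawGraph n γ) := by
  have := isProbabilityMeasure_paretoMeasure one_pos (by linarith : 0 < γ - 1)
  have h := eventually_le_lintegral_edge
    (integrable_id_pareto (by linarith : 1 < γ - 1)) (ae_one_le_pareto _) hδ
  rwa [integral_id_degree hγ] at h

variable {K r T : ℕ}

/-- The coded load is controlled by the excess edge counts. -/
lemma lintegral_minLoad_le {n : ℕ} (hn : 0 < n) (hT : 0 < T) (hr : 1 ≤ r)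
    (μ : Measure (LoopGraph n)) [IsProbabilityMeasure μ] (A : Allocation n K r)
    (f : Fin n → Finset (Fin K)) (hf : ∀ j k, k ∈ f j ↔ j ∈ A.map k) (hcard : ∀ j, (f j).card = r)
    {b c : ℝ} (hb : 0 ≤ b) (hc : 0 ≤ c)
    (hexc : ∀ k S, ∫⁻ G, ENNReal.ofReal ((edgesBetween G (A.reduce k) (batch f S)).card - c) ∂μ
      ≤ ENNReal.ofReal b) :
    ∫⁻ G, minLoad T A G ∂μ ≤ ENNReal.ofReal (((r : ℝ) + 1) / r / (n : ℝ) ^ 2 *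
      (K.choose (r + 1) * (c + r + (r + 1) * b))) := by
  classical
  set P := (Finset.univ : Finset (Fin K)).powersetCard (r + 1) with hP
  have hPc : P.card = K.choose (r + 1) := by
    rw [hP, Finset.card_powersetCard, Finset.card_univ, Fintype.card_fin]
  set q : ℝ := ((r : ℝ) + 1) / r / (n : ℝ) ^ 2 with hq
  have hq0 : 0 ≤ q := by positivity
  let X : LoopGraph n → Fin K → Finset (Fin K) → ℕ := fun G k S =>
    (edgesBetween G (A.reduce k) (batch f (S.erase k))).card
  have hpt : ∀ G, minLoad T A G ≤ ENNReal.ofReal q * ∑ S ∈ P,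
      (ENNReal.ofReal (c + r) + ∑ k ∈ S, ENNReal.ofReal (X G k S - c)) := by
    intro G
    refine (minLoad_le_coded hn hT hr f hf hcard (fun S => S.sup fun k => X G k S)
      fun S _ k hk => Finset.le_sup (f := fun k => X G k S) hk).trans ?_
    rw [show ((r : ℝ) + 1) / r *
      (∑ S ∈ (Finset.univ : Finset (Fin K)).powersetCard (r + 1),
        (((S.sup fun k => X G k S : ℕ) : ℝ) + r)) / (n : ℝ) ^ 2
      = q * ∑ S ∈ P, (((S.sup fun k => X G k S : ℕ) : ℝ) + r) by rw [hq]; ring,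
      ENNReal.ofReal_mul hq0]
    gcongr
    rw [ENNReal.ofReal_sum_of_nonneg fun S _ => by positivity]
    refine Finset.sum_le_sum fun S hS => ?_
    have hne : S.Nonempty := Finset.card_pos.1 (by rw [(Finset.mem_powersetCard.1 hS).2]; omega)
    -- The maximal count is at most `c` plus the positive excess of one member of S, hence at most
    -- `c` plus the sum of all r + 1 positive excesses; `ENNReal.ofReal` takes the positive part.
    obtain ⟨k, hk, hsup⟩ := Finset.exists_mem_eq_sup S hne fun k => X G k S
    rw [hsup]
    calc ENNReal.ofReal ((X G k S : ℝ) + r)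
        = ENNReal.ofReal ((c + r) + (X G k S - c)) := by congr 1; ring
      _ ≤ ENNReal.ofReal (c + r) + ENNReal.ofReal (X G k S - c) := ENNReal.ofReal_add_le
      _ ≤ _ := by
        gcongr
        exact Finset.single_le_sum (f := fun k => ENNReal.ofReal ((X G k S : ℝ) - c))
          (fun _ _ => zero_le) hk
  calc ∫⁻ G, minLoad T A G ∂μ
      ≤ ∫⁻ G, ENNReal.ofReal q * ∑ S ∈ P,
      (ENNReal.ofReal (c + r) + ∑ k ∈ S, ENNReal.ofReal (X G k S - c)) ∂μ := lintegral_mono hpt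
    _ = ENNReal.ofReal q * ∑ S ∈ P, (ENNReal.ofReal (c + r) +
          ∑ k ∈ S, ∫⁻ G, ENNReal.ofReal (X G k S - c) ∂μ) := by
        rw [lintegral_const_mul _ Measurable.of_discrete,
          lintegral_finsetSum _ fun _ _ => Measurable.of_discrete]
        congr 1
        refine Finset.sum_congr rfl fun S _ => ?_
        rw [lintegral_add_left measurable_const, lintegral_const, measure_univ, mul_one,
          lintegral_finsetSum _ fun _ _ => Measurable.of_discrete]
    _ ≤ ENNReal.ofReal q * ∑ S ∈ P, (ENNReal.ofReal (c + r) + ∑ k ∈ S, ENNReal.ofReal b) := by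
        gcongr with S _ k _
        exact hexc k _
    _ = ENNReal.ofReal q * ∑ S ∈ P, ENNReal.ofReal (c + r + (r + 1) * b) := by
        congr 1
        refine Finset.sum_congr rfl fun S hS => ?_
        rw [Finset.sum_const, (Finset.mem_powersetCard.1 hS).2, nsmul_eq_mul,
          ← ENNReal.ofReal_natCast, ← ENNReal.ofReal_mul (by positivity),
          ← ENNReal.ofReal_add (by positivity) (by positivity)]
        push_cast
        rfl
    _ = _ := by
        rw [Finset.sum_const, hPc, nsmul_eq_mul, ENNReal.ofReal_mul hq0,
          ENNReal.ofReal_mul (by positivity), ENNReal.ofReal_natCast]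

/-- The average load of the coded scheme. -/
theorem eventually_minAverageLoad_le (hr : 1 ≤ r) (hrK : r ≤ K) (hT : 0 < T) (hγ : 2 < γ) {ε : ℝ}
    (hε : 0 < ε) :
    ∀ᶠ n : ℕ in atTop, (n : ℝ≥0∞) * minAverageLoad K r T (powerLawGraph n γ)
      ≤ ENNReal.ofReal ((γ - 1) / (γ - 2) * (1 / (r : ℝ) * (1 - (r : ℝ) / K)) + ε) := by
  set m := (γ - 1) / (γ - 2) with hm
  have hm0 : 0 < m := div_pos (by linarith) (by linarith)
  have hr0 : (0 : ℝ) < r := by exact_mod_cast hr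
  have hK0 : (0 : ℝ) < K := by exact_mod_cast hr.trans hrK
  set C := K.choose r with hC
  set C' := K.choose (r + 1) with hC'
  have hC0 : (0 : ℝ) < C := by exact_mod_cast Nat.choose_pos hrK
  -- This identity produces the factor 1 - r/K in the limit.
  have hCC' : (C' : ℝ) * (r + 1) = C * (K - r) := by
    have := Nat.choose_succ_right_eq K r
    rw [← Nat.cast_sub hrK]
    exact_mod_cast this
  -- All excesses together then contribute at most ε/2; the `+ 1` keeps `δ` positive when r = K,
  -- where C' = 0.
  set δ := ε / (2 * (((r : ℝ) + 1) / r * (C' * (r + 1)) + 1)) with hδ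
  have hδ0 : 0 < δ := by positivity
  let c : ℕ → ℝ := fun n => ((n : ℝ) / K + 1) * ((n : ℝ) / C + C) * m / n
  have hlim : Tendsto (fun n : ℕ => ((r : ℝ) + 1) / r * C' * ((c n + r) / n)) atTop
      (𝓝 (m * (1 / (r : ℝ) * (1 - (r : ℝ) / K)))) := by
    have hinv : Tendsto (fun n : ℕ => ((n : ℝ))⁻¹) atTop (𝓝 0) := tendsto_inv_atTop_nhds_zero_nat
    have h1 : Tendsto (fun n : ℕ => ((r : ℝ) + 1) / r * C' *
        ((1 / K + (n : ℝ)⁻¹) * (1 / C + C * (n : ℝ)⁻¹) * m + r * (n : ℝ)⁻¹)) atTop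
        (𝓝 (((r : ℝ) + 1) / r * C' * ((1 / K + 0) * (1 / C + C * 0) * m + r * 0))) := by
      exact ((((hinv.const_add _).mul ((hinv.const_mul _).const_add _)).mul_const m).add
        (hinv.const_mul _)).const_mul _
    have h2 : ((r : ℝ) + 1) / r * C' * ((1 / K + 0) * (1 / C + C * 0) * m + r * 0)
        = m * (1 / (r : ℝ) * (1 - (r : ℝ) / K)) := by
      have h3 : ((r : ℝ) + 1) / r * C' * ((1 / K + 0) * (1 / C + C * 0) * m + r * 0)
          = (C' * ((r : ℝ) + 1)) * m / (r * K * C) := by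
        field_simp
        ring
      rw [h3, hCC']
      field_simp
    rw [h2] at h1
    refine h1.congr' ?_
    filter_upwards [eventually_gt_atTop 0] with n hn
    have hn' : (0 : ℝ) < n := by exact_mod_cast hn
    simp only [c]
    field_simp
  filter_upwards [eventually_gt_atTop 0, eventually_powerLaw_excess_le hγ hδ0,
    hlim.eventually_le_const (lt_add_of_pos_right _ (half_pos hε))] with n hn hexc hle
  have hn' : (0 : ℝ) < n := by exact_mod_cast hn
  have hprob := isProbabilityMeasure_powerLawGraph n (by linarith : 1 < γ)
  obtain ⟨A, f, hf, hcard, hR, hB⟩ := exists_batched_allocation hr hrK n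
  have hc0 : 0 ≤ c n := by simp only [c]; positivity
  have hload := lintegral_minLoad_le (T := T) hn hT hr (powerLawGraph n γ) A f hf hcard
    (b := δ * n) (c := c n) (by positivity) hc0 (fun k S => hexc _ _ _ (by
      simp only [c]
      gcongr
      · exact hR k
      · exact hB S))
  calc (n : ℝ≥0∞) * minAverageLoad K r T (powerLawGraph n γ)
      ≤ n * ENNReal.ofReal (((r : ℝ) + 1) / r / (n : ℝ) ^ 2 *
      (C' * (c n + r + (r + 1) * (δ * n)))) := by
        gcongr
        exact (iInf_le _ A).trans hload
    _ = ENNReal.ofReal (n * (((r : ℝ) + 1) / r / (n : ℝ) ^ 2 *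
      (C' * (c n + r + (r + 1) * (δ * n))))) := by
        rw [ENNReal.ofReal_mul hn'.le, ENNReal.ofReal_natCast]
    _ ≤ _ := by
        refine ENNReal.ofReal_le_ofReal ?_
        have h1 : n * (((r : ℝ) + 1) / r / (n : ℝ) ^ 2 * (C' * (c n + r + (r + 1) * (δ * n))))
            = ((r : ℝ) + 1) / r * C' * ((c n + r) / n) + ((r : ℝ) + 1) / r * (C' * (r + 1)) * δ := by
          field_simp
        have h2 : ((r : ℝ) + 1) / r * (C' * (r + 1)) * δ ≤ ε / 2 := by
          set y := ((r : ℝ) + 1) / r * (C' * (r + 1)) with hy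
          have hy0 : 0 ≤ y := by positivity
          rw [hδ, mul_div_assoc', div_le_div_iff₀ (by positivity) (by positivity)]
          nlinarith
        rw [h1]
        linarith

lemma uncodedLoad_eq {n : ℕ} (hT : 0 < T) (hn : 0 < n) (A : Allocation n K r) (G : LoopGraph n) :
    (n : ℝ≥0∞) * uncodedLoad T A G
      = ENNReal.ofReal (1 / n) * ∑ k, ((edgesBetween G (A.reduce k) (A.map k)ᶜ).card : ℝ≥0∞) := by
  have hN : ∀ k, (NeededIdx G A k).ncard = (edgesBetween G (A.reduce k) (A.map k)ᶜ).card := by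
    intro k
    rw [← Set.ncard_coe_finset]
    congr 1
    ext p
    simp [NeededIdx, edgesBetween, ValueIdx, LoopGraph.Adj, and_comm]
  have hn' : (0 : ℝ) < n := by exact_mod_cast hn
  have hT' : (0 : ℝ) < T := by exact_mod_cast hT
  rw [uncodedLoad, normalizedLoad_eq_ofReal hn hT, ← ENNReal.ofReal_natCast n,
    ← ENNReal.ofReal_mul hn'.le, ← Nat.cast_sum, ← ENNReal.ofReal_natCast,
    ← ENNReal.ofReal_mul (by positivity), ← Finset.sum_mul]
  simp_rw [hN]
  congr 1
  push_cast
  field_simp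

lemma sum_card_reduce {n : ℕ} (A : Allocation n K r) : ∑ k, (A.reduce k).card = n := by
  classical
  choose own hown huniq using A.reduce_partition
  have h : ∀ k, (A.reduce k).card = ∑ i : Fin n, if own i = k then 1 else 0 := by
    intro k
    rw [← Finset.card_filter]
    congr 1
    ext i
    simp only [Finset.mem_filter, Finset.mem_univ, true_and]
    exact ⟨fun hi => (huniq i k hi).symm, fun hi => hi ▸ hown i⟩
  simp_rw [h]
  rw [Finset.sum_comm]
  simp

/-- The number of pairs of a vertex Reduced by a machine and a vertex not Mapped by it is
`n ^ 2 (1 - r / K) + O(n)`. -/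
lemma abs_sum_card_mul_card_sub_le {n : ℕ} (A : Allocation n K r) :
    |∑ k, ((A.reduce k).card : ℝ) * ((A.map k)ᶜ.card : ℝ) - (n : ℝ) ^ 2 * (1 - (r : ℝ) / K)|
      ≤ (n : ℝ) := by
  have hs : ∑ k, ((A.reduce k).card : ℝ) = n := by exact_mod_cast sum_card_reduce A
  have h1 : ∀ k, |((A.map k)ᶜ.card : ℝ) - n * (1 - (r : ℝ) / K)| ≤ 1 := by
    intro k
    have h2 := abs_sub_average_le_one A.map_equal k
    rw [A.map_load] at h2
    rw [Finset.card_compl, Fintype.card_fin,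
      Nat.cast_sub ((Finset.card_le_univ _).trans (by simp)), abs_sub_comm]
    convert h2 using 2
    push_cast
    ring
  -- The Reduce sizes add up to n, so they act as weights on the rounding errors of the Map sizes,
  -- each at most 1.
  have h3 : ∑ k, ((A.reduce k).card : ℝ) * ((A.map k)ᶜ.card : ℝ)
      - (n : ℝ) ^ 2 * (1 - (r : ℝ) / K)
      = ∑ k, ((A.reduce k).card : ℝ) * (((A.map k)ᶜ.card : ℝ) - n * (1 - (r : ℝ) / K)) := by
    generalize hy : (n : ℝ) * (1 - (r : ℝ) / K) = y
    simp_rw [mul_sub]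
    rw [Finset.sum_sub_distrib, ← Finset.sum_mul, hs, ← hy]
    ring
  rw [h3]
  calc _ ≤ ∑ k, |((A.reduce k).card : ℝ) * (((A.map k)ᶜ.card : ℝ) - n * (1 - (r : ℝ) / K))| :=
        Finset.abs_sum_le_sum_abs _ _
    _ ≤ ∑ k, ((A.reduce k).card : ℝ) * 1 := by
        refine Finset.sum_le_sum fun k _ => ?_
        rw [abs_mul, Nat.abs_cast]
        gcongr
        exact h1 k
    _ = n := by rw [← Finset.sum_mul, hs, mul_one]

lemma lintegral_uncodedLoad {n : ℕ} (hT : 0 < T) (hn : 0 < n) (A : Allocation n K r)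
    (μ : Measure (LoopGraph n)) :
    (n : ℝ≥0∞) * ∫⁻ G, uncodedLoad T A G ∂μ = ENNReal.ofReal (1 / n) *
      ∑ k, ∫⁻ G, ((edgesBetween G (A.reduce k) (A.map k)ᶜ).card : ℝ≥0∞) ∂μ := by
  rw [← lintegral_const_mul _ Measurable.of_discrete]
  simp_rw [uncodedLoad_eq hT hn]
  rw [lintegral_const_mul _ Measurable.of_discrete,
    lintegral_finsetSum _ fun _ _ => Measurable.of_discrete]

lemma lintegral_card_edgesBetween_le {n : ℕ} {μ : Measure (LoopGraph n)} [IsProbabilityMeasure μ]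
    {R B : Finset (Fin n)} {b c : ℝ} (hb : 0 ≤ b) (hc : 0 ≤ c)
    (h : ∫⁻ G, ENNReal.ofReal ((edgesBetween G R B).card - c) ∂μ ≤ ENNReal.ofReal b) :
    ∫⁻ G, ((edgesBetween G R B).card : ℝ≥0∞) ∂μ ≤ ENNReal.ofReal (c + b) := by
  calc ∫⁻ G, ((edgesBetween G R B).card : ℝ≥0∞) ∂μ
      ≤ ∫⁻ G, (ENNReal.ofReal c + ENNReal.ofReal ((edgesBetween G R B).card - c)) ∂μ := by
        refine lintegral_mono fun G => ?_
        rw [← ENNReal.ofReal_natCast]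
        refine le_trans (le_of_eq ?_) ENNReal.ofReal_add_le
        congr 1
        ring
    _ ≤ ENNReal.ofReal c + ENNReal.ofReal b := by
        rw [lintegral_add_left measurable_const, lintegral_const, measure_univ, mul_one]
        gcongr
    _ = _ := (ENNReal.ofReal_add hc hb).symm

/-- Loops are discarded: the diagonal meets `R ×ˢ B` in at most |R| pairs. -/
lemma le_lintegral_card_edgesBetween {n : ℕ} {μ : Measure (LoopGraph n)} {p : ℝ} (hp : 0 ≤ p)
    (h : ∀ i j : Fin n, i ≠ j →
      ENNReal.ofReal p ≤ ∫⁻ G, (if G s(i, j) = true then 1 else 0) ∂μ) (R B : Finset (Fin n)) :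
    ENNReal.ofReal (((R.card : ℝ) * B.card - R.card) * p)
      ≤ ∫⁻ G, ((edgesBetween G R B).card : ℝ≥0∞) ∂μ := by
  classical
  have h1 : ∀ G : LoopGraph n, ((edgesBetween G R B).card : ℝ≥0∞)
      = ∑ p ∈ R ×ˢ B, if G s(p.1, p.2) = true then (1 : ℝ≥0∞) else 0 := by
    intro G
    simp [edgesBetween]
  simp_rw [h1]
  rw [lintegral_finsetSum _ fun _ _ => Measurable.of_discrete]
  set Q := (R ×ˢ B).filter fun p => p.1 ≠ p.2 with hQ
  have hcard : (R.card : ℝ) * B.card - R.card ≤ Q.card := by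
    have h2 : ((R ×ˢ B).filter fun p => ¬ p.1 ≠ p.2).card ≤ R.card := by
      refine Finset.card_le_card_of_injOn Prod.fst (fun p hp => ?_) fun p hp q hq hpq => ?_
      · exact (Finset.mem_product.1 (Finset.mem_filter.1 hp).1).1
      · have e1 := (Finset.mem_filter.1 hp).2
        have e2 := (Finset.mem_filter.1 hq).2
        rw [not_not] at e1 e2
        exact Prod.ext hpq (by rw [← e1, ← e2, hpq])
    have h3 := Finset.card_filter_add_card_filter_not (s := R ×ˢ B) (fun p => p.1 ≠ p.2)
    rw [Finset.card_product, ← hQ] at h3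
    have h4 : R.card * B.card ≤ Q.card + R.card := by omega
    have h5 : (R.card : ℝ) * B.card ≤ Q.card + R.card := by exact_mod_cast h4
    linarith
  calc ENNReal.ofReal (((R.card : ℝ) * B.card - R.card) * p)
      ≤ ENNReal.ofReal (Q.card * p) := ENNReal.ofReal_le_ofReal (by gcongr)
    _ = ∑ _p ∈ Q, ENNReal.ofReal p := by
        rw [Finset.sum_const, nsmul_eq_mul, ENNReal.ofReal_mul (by positivity),
          ENNReal.ofReal_natCast]
    _ ≤ ∑ p ∈ Q, ∫⁻ G, (if G s(p.1, p.2) = true then 1 else 0) ∂μ :=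
        Finset.sum_le_sum fun p hp => h _ _ (Finset.mem_filter.1 hp).2
    _ ≤ _ := Finset.sum_le_sum_of_subset (Finset.filter_subset _ _)

/-- The average uncoded load. -/
theorem eventually_uncodedLoad (hrK : r ≤ K) (hr : 1 ≤ r) (hT : 0 < T) (hγ : 2 < γ) {ε : ℝ}
    (hε : 0 < ε) (A : (n : ℕ) → Allocation n K r) :
    ∀ᶠ n : ℕ in atTop,
      ENNReal.ofReal ((1 - (r : ℝ) / K) * ((γ - 1) / (γ - 2)) - ε)
        ≤ (n : ℝ≥0∞) * ∫⁻ G, uncodedLoad T (A n) G ∂(powerLawGraph n γ) ∧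
      (n : ℝ≥0∞) * ∫⁻ G, uncodedLoad T (A n) G ∂(powerLawGraph n γ)
        ≤ ENNReal.ofReal ((1 - (r : ℝ) / K) * ((γ - 1) / (γ - 2)) + ε) := by
  set m := (γ - 1) / (γ - 2) with hm
  have hm0 : 0 < m := div_pos (by linarith) (by linarith)
  have hK0 : (0 : ℝ) < K := by exact_mod_cast hr.trans hrK
  -- The minimum with `m` keeps the lower bound (m - δ)/n on edge probabilities nonnegative.
  have hδ0 : 0 < min m (ε / 2) := lt_min hm0 (half_pos hε)
  have hη0 : 0 < ε / (2 * K) := by positivity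
  have hlarge : ∀ᶠ n : ℕ in atTop, 2 * m ≤ ε / 2 * n :=
    (tendsto_natCast_atTop_atTop.const_mul_atTop (half_pos hε)).eventually_ge_atTop _
  set δ := min m (ε / 2) with hδ
  set x := 1 - (r : ℝ) / K with hx
  have hx1 : x ≤ 1 := by
    have : 0 ≤ (r : ℝ) / K := by positivity
    linarith
  filter_upwards [eventually_gt_atTop 0, hlarge, eventually_powerLaw_excess_le hγ hη0,
    eventually_le_powerLaw_edge hγ hδ0] with n hn hle hexc hedge
  have hn' : (0 : ℝ) < n := by exact_mod_cast hn
  have hprob := isProbabilityMeasure_powerLawGraph n (by linarith : 1 < γ)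
  rw [lintegral_uncodedLoad hT hn]
  have hsum := abs_le.1 (abs_sum_card_mul_card_sub_le (A n))
  have hs : ∑ k, (((A n).reduce k).card : ℝ) = n := by exact_mod_cast sum_card_reduce (A n)
  set s := ∑ k, (((A n).reduce k).card : ℝ) * ((((A n).map k)ᶜ).card : ℝ) with hsdef
  have hmn : 2 * m / n ≤ ε / 2 := (div_le_iff₀ hn').2 hle
  constructor
  · have hp : 0 ≤ (m - δ) / n := div_nonneg (sub_nonneg.2 (min_le_left _ _)) hn'.le
    calc ENNReal.ofReal (x * m - ε) ≤ ENNReal.ofReal (1 / n * ((s - n) * ((m - δ) / n))) := by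
          refine ENNReal.ofReal_le_ofReal ?_
          -- One n is lost to rounding of the allocation, the other to the loops.
          have h1 : (n : ℝ) ^ 2 * x - 2 * n ≤ s - n := by linarith [hsum.1]
          have h2 : 1 / n * (((n : ℝ) ^ 2 * x - 2 * n) * ((m - δ) / n))
              ≤ 1 / n * ((s - n) * ((m - δ) / n)) := by gcongr
          refine le_trans ?_ h2
          have h3 : 1 / n * (((n : ℝ) ^ 2 * x - 2 * n) * ((m - δ) / n))
              = x * m - x * δ - 2 * m / n + 2 * δ / n := by
            field_simp
            ring
          have h4 : x * δ ≤ 1 * δ := mul_le_mul_of_nonneg_right hx1 hδ0.le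
          have h5 : δ ≤ ε / 2 := min_le_right _ _
          have h6 : 0 ≤ 2 * δ / n := by positivity
          rw [h3]
          linarith
      _ ≤ ENNReal.ofReal (1 / n) * ∑ k, ENNReal.ofReal
            (((((A n).reduce k).card : ℝ) * ((((A n).map k)ᶜ).card : ℝ)
              - ((A n).reduce k).card) * ((m - δ) / n)) := by
          rw [ENNReal.ofReal_mul (by positivity)]
          gcongr
          rw [← hs, hsdef, ← Finset.sum_sub_distrib, Finset.sum_mul, hs]
          -- Only subadditivity is used, since single terms may be negative, for instance when a
          -- machine Maps every vertex.
          exact Finset.le_sum_of_subadditive ENNReal.ofReal ENNReal.ofReal_zero.le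
            (fun _ _ => ENNReal.ofReal_add_le) _ _
      _ ≤ _ := by
          gcongr with k _
          exact le_lintegral_card_edgesBetween hp hedge _ _
  · calc _ ≤ ENNReal.ofReal (1 / n) * ∑ k : Fin K, ENNReal.ofReal
            ((((A n).reduce k).card : ℝ) * ((((A n).map k)ᶜ).card : ℝ) * m / n
              + ε / (2 * K) * n) := by
          gcongr with k _
          exact lintegral_card_edgesBetween_le (by positivity) (by positivity)
            (hexc _ _ _ le_rfl)
      _ = ENNReal.ofReal (1 / n * (s * m / n + ε / 2 * n)) := by
          rw [← ENNReal.ofReal_sum_of_nonneg fun k _ => by positivity,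
            ← ENNReal.ofReal_mul (by positivity), Finset.sum_add_distrib, ← Finset.sum_div,
            ← Finset.sum_mul, Finset.sum_const, Finset.card_univ, Fintype.card_fin, nsmul_eq_mul]
          congr 3
          field_simp
      _ ≤ _ := by
          refine ENNReal.ofReal_le_ofReal ?_
          have h1 : s ≤ (n : ℝ) ^ 2 * x + n := by linarith [hsum.2]
          have h2 : 1 / n * (s * m / n + ε / 2 * n)
              ≤ 1 / n * (((n : ℝ) ^ 2 * x + n) * m / n + ε / 2 * n) := by gcongr
          refine h2.trans ?_
          have h3 : 1 / n * (((n : ℝ) ^ 2 * x + n) * m / n + ε / 2 * n)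
              = x * m + m / n + ε / 2 := by
            field_simp
          have h4 : m / n ≤ 2 * m / n := by gcongr; linarith
          rw [h3]
          linarith

end PowerLaw

/-! ### Limits of extended real sequences with error bounds -/

section Limits

lemma tendsto_ofReal_of_forall_eventually {u : ℕ → ℝ≥0∞} {a : ℝ}
    (h : ∀ ε : ℝ, 0 < ε → ∀ᶠ n in atTop,
      ENNReal.ofReal (a - ε) ≤ u n ∧ u n ≤ ENNReal.ofReal (a + ε)) :
    Tendsto u atTop (𝓝 (ENNReal.ofReal a)) := by
  rw [ENNReal.tendsto_nhds ENNReal.ofReal_ne_top]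
  intro ε hε
  -- The tolerance may be `⊤`, whose `toReal` is 0; capping it at 1 yields a positive real.
  have hne : min ε 1 ≠ ⊤ := ne_top_of_le_ne_top ENNReal.one_ne_top (min_le_right _ _)
  have hpos : 0 < (min ε 1).toReal := ENNReal.toReal_pos (lt_min hε one_pos).ne' hne
  have hle : ENNReal.ofReal (min ε 1).toReal ≤ ε := by
    rw [ENNReal.ofReal_toReal hne]
    exact min_le_left _ _
  filter_upwards [h _ hpos] with n hn
  constructor
  · refine (tsub_le_tsub_left hle _).trans ?_
    rw [← ENNReal.ofReal_sub _ hpos.le]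
    exact hn.1
  · exact hn.2.trans (ENNReal.ofReal_add_le.trans (by gcongr))

lemma limsup_le_ofReal_of_forall_eventually {u : ℕ → ℝ≥0∞} {a : ℝ}
    (h : ∀ ε : ℝ, 0 < ε → ∀ᶠ n in atTop, u n ≤ ENNReal.ofReal (a + ε)) :
    limsup u atTop ≤ ENNReal.ofReal a := by
  refine ENNReal.le_of_forall_pos_le_add fun ε hε _ => ?_
  refine limsup_le_of_le (h := ?_)
  filter_upwards [h ε (by exact_mod_cast hε)] with n hn
  refine hn.trans (ENNReal.ofReal_add_le.trans ?_)
  rw [ENNReal.ofReal_coe_nnreal]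

end Limits

end CodedGraph

theorem theorem4 (K r T : ℕ) (hr : 1 ≤ r) (hrK : r ≤ K) (hT : 0 < T) (γ : ℝ) (hγ : 2 < γ) :
    limsup (fun n : ℕ => (n : ℝ≥0∞) *
        CodedGraph.minAverageLoad K r T (CodedGraph.powerLawGraph n γ) /
          ENNReal.ofReal ((γ - 1) / (γ - 2))) atTop
      ≤ ENNReal.ofReal (1 / (r : ℝ) * (1 - (r : ℝ) / (K : ℝ))) ∧
    ∀ A : (n : ℕ) → CodedGraph.Allocation n K r,
      Tendsto (fun n : ℕ => (n : ℝ≥0∞) *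
          ∫⁻ G, CodedGraph.uncodedLoad T (A n) G ∂(CodedGraph.powerLawGraph n γ)) atTop
        (𝓝 (ENNReal.ofReal ((1 - (r : ℝ) / (K : ℝ)) * ((γ - 1) / (γ - 2))))) := by
  refine ⟨CodedGraph.limsup_le_ofReal_of_forall_eventually fun ε hε => ?_, fun A =>
    CodedGraph.tendsto_ofReal_of_forall_eventually fun ε hε =>
      CodedGraph.eventually_uncodedLoad hrK hr hT hγ hε A⟩
  have hm0 : 0 < (γ - 1) / (γ - 2) := div_pos (by linarith) (by linarith)
  -- The error is scaled by the mean degree so that it becomes `ε` after the division.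
  filter_upwards [CodedGraph.eventually_minAverageLoad_le hr hrK hT hγ (mul_pos hm0 hε)] with n hn
  rw [ENNReal.div_le_iff (ENNReal.ofReal_pos.2 hm0).ne' ENNReal.ofReal_ne_top,
    ← ENNReal.ofReal_mul' hm0.le]
  refine hn.trans (le_of_eq ?_)
  congr 1
  ring
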